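/- Asymptotic CGMT. Fix $M\in\mathbb N$. For each $t\in\mathbb N$ let $p=p_t$, $n=n_t$ be dimensions, let $\mathcal S_w\subset\mathbb R^{p}$ and $\mathcal S_u\subset\mathbb R^{n}$ be compact and convex, and let $f:\mathcal S_w\times\mathcal S_u\to\mathbb R$ be continuous, convex in its first and concave in its second argument. Let $\mathbf H$ be a centred, jointly Gaussian random $p\times n$ matrix such that $$\mathrm{Cov}[\mathbf H_{ji},\mathbf H_{j'i'}]=\sum_{l=1}^M\Sigma^{(l)}_{jj'}\tilde\Sigma^{(l)}_{ii'}\qquad\text{for all } i,i'\le n,\ j,j'\le p,$$ with symmetric positive semi-definite matrices $\Sigma^{(l)}\in\mathbb R^{p\times p}$, $\tilde\Sigma^{(l)}\in\mathbb R^{n\times n}$. Let $\mathbf h_1,\dots,\mathbf h_M\in\mathbb R^n$ and $\mathbf g_1,\dots,\mathbf g_M\in\mathbb R^p$ be independent standard Gaussian vectors, and write $\|v\|_{\Sigma'}=\sqrt{v^\intercal\Sigma' v}$. (All objects except $M$ may depend on $t$, including the probability space.) Set $$L_\Psi(w,u)=w^\intercal\mathbf Hu+f(w,u),$$ $$L_\psi(w,u)=\sum_{l=1}^M\Big\{\|w\|_{\Sigma^{(l)}}\,\mathbf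 h_l^\intercal(\tilde\Sigma^{(l)})^{1/2}u+w^\intercal(\Sigma^{(l)})^{1/2}\mathbf g_l\,\|u\|_{\tilde\Sigma^{(l)}}\Big\}+f(w,u),$$ and, for $W\subseteq\mathcal S_w$, $\psi_{W,\mathcal S_u}=\min_{w\in W}\max_{u\in\mathcal S_u}L_\psi(w,u)$ (equal to $+\infty$ if $W=\emptyset$). Let $\hat w_\Psi$ be any minimizer over $w\in\mathcal S_w$ of $\max_{u\in\mathcal S_u}L_\Psi(w,u)$. Let $\mathcal A_p$ be a (deterministic) relatively open subset of $\mathcal S_w$ and $\mathcal A_p^c=\mathcal S_w\setminus\mathcal A_p$. If there are constants $\bar\psi<\bar\psi^c$ in $\mathbb R$, independent of $t$, such that, as $t\to\infty$, $\psi_{\mathcal S_w,\mathcal S_u}\to\bar\psi$ and $\psi_{\mathcal A_p^c,\mathcal S_u}\to\bar\psi^c$ in probability, then $$\mathbb P(\hat w_\Psi\in\mathcal A_p)\to1\qquad(t\to\infty).$$ -/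

import Mathlib

open MeasureTheory ProbabilityTheory Filter Topology Matrix
open scoped MatrixOrder

namespace CGMT

/-- The seminorm `‖v‖_C = √(vᵀ C v)` attached to a positive semi-definite matrix `C`. -/
noncomputable def wnorm {d : ℕ} (C : Matrix (Fin d) (Fin d) ℝ) (v : Fin d → ℝ) : ℝ :=
  Real.sqrt (v ⬝ᵥ (C *ᵥ v))

/-- The primary loss `wᵀ H u + f(w,u)`. -/
def primaryLoss {p n : ℕ} (f : (Fin p → ℝ) → (Fin n → ℝ) → ℝ) (H : Matrix (Fin p) (Fin n) ℝ)
    (w : Fin p → ℝ) (u : Fin n → ℝ) : ℝ :=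
  w ⬝ᵥ (H *ᵥ u) + f w u

/-- The auxiliary loss
`∑ₗ (‖w‖_{C l} h_lᵀ (D l)^{1/2} u + wᵀ (C l)^{1/2} g_l ‖u‖_{D l}) + f(w,u)`,
where `CFC.sqrt` is the positive semi-definite square root of a positive semi-definite matrix. -/
noncomputable def auxLoss {p n M : ℕ} (f : (Fin p → ℝ) → (Fin n → ℝ) → ℝ)
    (C : Fin M → Matrix (Fin p) (Fin p) ℝ) (D : Fin M → Matrix (Fin n) (Fin n) ℝ)
    (h : Fin M → Fin n → ℝ) (g : Fin M → Fin p → ℝ)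
    (w : Fin p → ℝ) (u : Fin n → ℝ) : ℝ :=
  ∑ l, (wnorm (C l) w * (h l ⬝ᵥ (CFC.sqrt (D l) *ᵥ u))
      + (w ⬝ᵥ (CFC.sqrt (C l) *ᵥ g l)) * wnorm (D l) u) + f w u

/-- `max_{u ∈ U} L(w,u)`, as an extended real number. -/
noncomputable def innerMax {p n : ℕ} (L : (Fin p → ℝ) → (Fin n → ℝ) → ℝ)
    (U : Set (Fin n → ℝ)) (w : Fin p → ℝ) : EReal :=
  ⨆ u ∈ U, (L w u : EReal)

/-- `min_{w ∈ W} max_{u ∈ U} L(w,u)`, as an extended real number (the minimum over the empty set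
is `+∞`). For `W`, `U` compact and `L` continuous on `W × U`, both extrema are attained as soon as
the sets are non-empty. -/
noncomputable def minMax {p n : ℕ} (L : (Fin p → ℝ) → (Fin n → ℝ) → ℝ)
    (W : Set (Fin p → ℝ)) (U : Set (Fin n → ℝ)) : EReal :=
  ⨅ w ∈ W, innerMax L U w

/-- `w` is a minimizer over `W` of `w ↦ max_{u ∈ U} L(w,u)`. -/
def IsMinimizer {p n : ℕ} (L : (Fin p → ℝ) → (Fin n → ℝ) → ℝ)
    (W : Set (Fin p → ℝ)) (U : Set (Fin n → ℝ)) (w : Fin p → ℝ) : Prop :=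
  w ∈ W ∧ ∀ w' ∈ W, innerMax L U w ≤ innerMax L U w'

/-- `H` is a centred, jointly Gaussian random `p × n` matrix with
`Cov[H j i, H j' i'] = ∑ₗ (C l) j j' (D l) i i'`, where all `C l`, `D l` are symmetric positive
semi-definite. -/
structure IsLowRankGaussian {Ω : Type*} [MeasurableSpace Ω] (P : Measure Ω) {p n M : ℕ}
    (H : Ω → Matrix (Fin p) (Fin n) ℝ)
    (C : Fin M → Matrix (Fin p) (Fin p) ℝ) (D : Fin M → Matrix (Fin n) (Fin n) ℝ) : Prop where
  gaussian : HasGaussianLaw (fun ω => fun k : Fin p × Fin n => H ω k.1 k.2) P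
  centred : ∀ j i, ∫ ω, H ω j i ∂P = 0
  posSemidef_left : ∀ l, (C l).PosSemidef
  posSemidef_right : ∀ l, (D l).PosSemidef
  covariance_eq : ∀ j i j' i',
    cov[fun ω => H ω j i, fun ω => H ω j' i'; P] = ∑ l, C l j j' * D l i i'

/-- `h 0, …, h (M-1)` in `ℝⁿ` and `g 0, …, g (M-1)` in `ℝᵖ` are independent standard Gaussian
vectors: all their coordinates together are i.i.d. `N(0,1)`. -/
def AreIndepStdGaussian {Ω : Type*} [MeasurableSpace Ω] (P : Measure Ω) {p n M : ℕ}
    (h : Ω → Fin M → Fin n → ℝ) (g : Ω → Fin M → Fin p → ℝ) : Prop :=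
  HasLaw (fun ω => fun k : Fin M × (Fin n ⊕ Fin p) => Sum.elim (h ω k.1) (g ω k.1) k.2)
    (Measure.pi fun _ => gaussianReal 0 1) P

/-- Convergence in probability to a real constant of a sequence of extended-real-valued random
variables, each defined on its own probability space: `P(|X - c| ≥ ε) → 0` for all `ε > 0`. -/
def TendstoInProb {Ω : ℕ → Type*} [∀ t, MeasurableSpace (Ω t)] (P : ∀ t, Measure (Ω t))
    (X : ∀ t, Ω t → EReal) (c : ℝ) : Prop :=
  ∀ ε : ℝ, 0 < ε → Tendsto
    (fun t => P t {ω | X t ω ≤ ((c - ε : ℝ) : EReal) ∨ ((c + ε : ℝ) : EReal) ≤ X t ω})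
    atTop (𝓝 0)

end CGMT

/-! The primary and auxiliary Gaussian fields are compared by Gordon's inequality. Put `r_l(w,u) =
‖w‖_{C l} ‖u‖_{D l}` and add to the primary field the noise `∑ r_l z_l`, with `z_1, …, z_M`
independent standard normal. The covariance of this augmented field minus that of the auxiliary
field is, for each `l`, a product of two Cauchy–Schwarz defects, one in `w` and one in `u`. It is
therefore nonnegative, and it vanishes when the two `w`'s or the two `u`'s coincide. Gordon's
inequality thus applies to the min-max and, after negation and exchange of the variables, to the
max-min. On the event that all `z_l ≤ 0` the noise is nonpositive, so removing it costs only the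
constant factor `P(z ≤ 0)^M`, which does not depend on the dimensions (`gordon_augmented`).

A minimizer in the compact bad set `K` forces either the primary value over `K` to be small or the
primary value over the whole domain to be large. The first event is controlled by the min-max
comparison. In the second, Sion's theorem turns the min-max into a max-min, whose upper tail is
compared with the auxiliary one; weak duality then suffices on the auxiliary side, which need not be
convex-concave. Both auxiliary events have vanishing probability because the limits are separated
(`measure_minimizer_mem_le`).

Gordon's inequality itself follows by interpolating between two Gaussian laws: a smooth test
function with nonnegative mixed differences wherever the covariances differ has monotone
expectation. Density and compactness arguments pass from finite families to continuous fields
(`gordon_finite`, `gordon_compact`). -/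

namespace CGMT

/-! ### Taylor expansion of functions with three bounded derivatives -/

section Taylor

variable {E : Type*} [NormedAddCommGroup E] [NormedSpace ℝ E]

/-- `F` is of class `C³` and its derivatives up to order three are bounded. -/
def BoundedC3 (F : E → ℝ) : Prop :=
  ContDiff ℝ 3 F ∧ ∃ C, ∀ k ≤ 3, ∀ x, ‖iteratedFDeriv ℝ k F x‖ ≤ C

lemma BoundedC3.contDiff {F : E → ℝ} (hF : BoundedC3 F) : ContDiff ℝ 3 F := hF.1

lemma BoundedC3.exists_bound {F : E → ℝ} (hF : BoundedC3 F) : ∃ C, ∀ x, ‖F x‖ ≤ C := by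
  obtain ⟨C, hC⟩ := hF.2
  exact ⟨C, fun x => by simpa using hC 0 (by norm_num) x⟩

lemma boundedC3_const (c : ℝ) : BoundedC3 (fun _ : E => c) := by
  refine ⟨contDiff_const, ‖c‖, fun k _ x => ?_⟩
  rcases Nat.eq_zero_or_pos k with rfl | hk
  · simp
  · rw [iteratedFDeriv_const_of_ne hk.ne']; simp

lemma BoundedC3.add {F G : E → ℝ} (hF : BoundedC3 F) (hG : BoundedC3 G) :
    BoundedC3 (fun x => F x + G x) := by
  obtain ⟨C, hC⟩ := hF.2
  obtain ⟨D, hD⟩ := hG.2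
  refine ⟨hF.1.add hG.1, C + D, fun k hk x => ?_⟩
  have hk' : (k : WithTop ℕ∞) ≤ 3 := by exact_mod_cast hk
  change ‖iteratedFDeriv ℝ k (F + G) x‖ ≤ _
  rw [iteratedFDeriv_add (hF.1.of_le hk') (hG.1.of_le hk')]
  exact (norm_add_le _ _).trans (add_le_add (hC k hk x) (hD k hk x))

lemma BoundedC3.mul {F G : E → ℝ} (hF : BoundedC3 F) (hG : BoundedC3 G) :
    BoundedC3 (fun x => F x * G x) := by
  obtain ⟨C, hC⟩ := hF.2
  obtain ⟨D, hD⟩ := hG.2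
  have hC0 : 0 ≤ C := (norm_nonneg _).trans (hC 0 (by norm_num) 0)
  have hD0 : 0 ≤ D := (norm_nonneg _).trans (hD 0 (by norm_num) 0)
  -- The factor 8 is `2 ^ 3`: the binomial coefficients in Leibniz' rule of order `k ≤ 3` sum to `2
  -- ^ k`.
  refine ⟨hF.1.mul hG.1, 8 * (C * D), fun k hk x => ?_⟩
  refine (norm_iteratedFDeriv_mul_le hF.1 hG.1 x (by exact_mod_cast hk)).trans ?_
  calc ∑ i ∈ Finset.range (k + 1),
        (k.choose i : ℝ) * ‖iteratedFDeriv ℝ i F x‖ * ‖iteratedFDeriv ℝ (k - i) G x‖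
      ≤ ∑ i ∈ Finset.range (k + 1), (k.choose i : ℝ) * (C * D) := by
        refine Finset.sum_le_sum fun i hi => ?_
        rw [mul_assoc]
        have hi' := Finset.mem_range.1 hi
        have := hC i (by omega) x
        have := hD (k - i) (by omega) x
        gcongr
    _ = (2 : ℝ) ^ k * (C * D) := by
        rw [← Finset.sum_mul]
        congr 1
        exact_mod_cast Nat.sum_range_choose k
    _ ≤ 8 * (C * D) := by
        gcongr
        calc (2 : ℝ) ^ k ≤ 2 ^ 3 := pow_le_pow_right₀ (by norm_num) hk
          _ = 8 := by norm_num

lemma BoundedC3.const_sub {F : E → ℝ} (hF : BoundedC3 F) (c : ℝ) :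
    BoundedC3 (fun x => c - F x) := by
  simpa [sub_eq_add_neg] using (boundedC3_const c).add ((boundedC3_const (-1)).mul hF)

lemma BoundedC3.prod {α : Type*} (s : Finset α) {F : α → E → ℝ} (hF : ∀ i, BoundedC3 (F i)) :
    BoundedC3 (fun x => ∏ i ∈ s, F i x) := by
  classical
  induction s using Finset.induction_on with
  | empty => simpa using boundedC3_const (E := E) 1
  | insert a s ha ih =>
    simp only [Finset.prod_insert ha]
    exact (hF a).mul ih

lemma BoundedC3.comp_clm {g : ℝ → ℝ} (hg : BoundedC3 g) (L : E →L[ℝ] ℝ) :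
    BoundedC3 (fun x => g (L x)) := by
  obtain ⟨C, hC⟩ := hg.2
  have hC0 : 0 ≤ C := (norm_nonneg _).trans (hC 0 (by norm_num) 0)
  refine ⟨hg.1.comp L.contDiff, C * (1 + ‖L‖) ^ 3, fun k hk x => ?_⟩
  have h := L.iteratedFDeriv_comp_right hg.1 x (i := k) (by exact_mod_cast hk)
  have h' : iteratedFDeriv ℝ k (fun x => g (L x)) x = _ := h
  rw [h']
  refine (ContinuousMultilinearMap.norm_compContinuousLinearMap_le _ _).trans ?_
  simp only [Finset.prod_const, Finset.card_univ, Fintype.card_fin]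
  have h1 : ‖L‖ ^ k ≤ (1 + ‖L‖) ^ 3 :=
    (pow_le_pow_left₀ (norm_nonneg _) (by linarith) k).trans
      (pow_le_pow_right₀ (by linarith [norm_nonneg L]) hk)
  exact mul_le_mul (hC k hk _) h1 (by positivity) hC0

/-- Second-order Taylor expansion with uniform cubic remainder. -/
lemma BoundedC3.exists_taylor {F : E → ℝ} (hF : BoundedC3 F) :
    ∃ C, 0 ≤ C ∧ ∀ x v : E,
      |F (x + v) - F x - fderiv ℝ F x v - (1 / 2) * fderiv ℝ (fderiv ℝ F) x v v| ≤ C * ‖v‖ ^ 3 := by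
  obtain ⟨C, hC⟩ := hF.2
  have hC0 : 0 ≤ C := (norm_nonneg _).trans (hC 0 (by norm_num) 0)
  have hF1 : ContDiff ℝ 2 (fderiv ℝ F) := hF.1.fderiv_right (by norm_num)
  have hF2 : ContDiff ℝ 1 (fderiv ℝ (fderiv ℝ F)) := hF1.fderiv_right (by norm_num)
  have hsymm : ∀ x, IsSymmSndFDerivAt ℝ F x := fun x =>
    hF.1.contDiffAt.isSymmSndFDerivAt (by simp; norm_num)
  -- The bound on the third derivative makes the Hessian Lipschitz. Two further applications of the
  -- mean value inequality each gain one power of `‖v‖`.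
  have hB : ∀ x y, ‖fderiv ℝ (fderiv ℝ F) y - fderiv ℝ (fderiv ℝ F) x‖ ≤ C * ‖y - x‖ := by
    intro x y
    refine convex_univ.norm_image_sub_le_of_norm_fderiv_le (𝕜 := ℝ)
      (fun z _ => (hF2.differentiable one_ne_zero) z) (fun z _ => ?_) trivial trivial
    have h3 := hC 3 le_rfl z
    rw [← norm_iteratedFDeriv_fderiv, ← norm_iteratedFDeriv_fderiv, ← norm_iteratedFDeriv_fderiv,
      norm_iteratedFDeriv_zero] at h3
    exact h3
  refine ⟨C, hC0, fun x v => ?_⟩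
  have hx : x ∈ Metric.closedBall x ‖v‖ := by simp
  have hG : ∀ z ∈ Metric.closedBall x ‖v‖,
      ‖fderiv ℝ F z - fderiv ℝ F x - fderiv ℝ (fderiv ℝ F) x (z - x)‖ ≤ C * ‖v‖ ^ 2 := by
    intro z hz
    have h := (convex_closedBall x ‖v‖).norm_image_sub_le_of_norm_hasFDerivWithin_le' (𝕜 := ℝ)
      (f := fderiv ℝ F) (f' := fderiv ℝ (fderiv ℝ F)) (C := C * ‖v‖)
      (φ := fderiv ℝ (fderiv ℝ F) x)
      (fun y _ => ((hF1.differentiable two_ne_zero) y).hasFDerivAt.hasFDerivWithinAt)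
      (fun y hy => (hB x y).trans (by
        have : ‖y - x‖ ≤ ‖v‖ := by simpa [dist_eq_norm] using hy
        gcongr)) hx hz
    refine h.trans ?_
    have : ‖z - x‖ ≤ ‖v‖ := by simpa [dist_eq_norm] using hz
    calc C * ‖v‖ * ‖z - x‖ ≤ C * ‖v‖ * ‖v‖ := by gcongr
      _ = C * ‖v‖ ^ 2 := by ring
  set B := fderiv ℝ (fderiv ℝ F) x with hBdef
  -- Symmetry of the Hessian gives the quadratic form `B (y - x) (y - x) / 2` the derivative `B (y -
  -- x)`.
  have hderiv : ∀ y, HasFDerivAt (fun y => F y - (1 / 2 : ℝ) * B (y - x) (y - x))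
      (fderiv ℝ F y - B (y - x)) y := by
    intro y
    have h1 := ((hF.1.differentiable (by norm_num)) y).hasFDerivAt
    have h2 : HasFDerivAt (fun y : E => y - x) (ContinuousLinearMap.id ℝ E) y :=
      (hasFDerivAt_id y).sub_const x
    have h3 := (B.hasFDerivAt.comp y h2).clm_apply h2
    have h4 := h1.sub (h3.const_mul (1 / 2 : ℝ))
    refine h4.congr_fderiv ?_
    ext w
    have := hsymm x w (y - x)
    simp [← hBdef] at this ⊢
    rw [this]; ring
  have h := (convex_closedBall x ‖v‖).norm_image_sub_le_of_norm_hasFDerivWithin_le' (𝕜 := ℝ)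
      (f := fun y => F y - (1 / 2 : ℝ) * B (y - x) (y - x))
      (f' := fun y => fderiv ℝ F y - B (y - x)) (C := C * ‖v‖ ^ 2)
      (φ := fderiv ℝ F x)
      (fun y _ => (hderiv y).hasFDerivWithinAt)
      (fun y hy => by
        have := hG y hy
        rwa [sub_right_comm] at this) hx (y := x + v) (by simp)
  simp only [add_sub_cancel_left, sub_self, map_zero, mul_zero, sub_zero] at h
  rw [Real.norm_eq_abs] at h
  calc _ = |F (x + v) - 1 / 2 * (B v) v - F x - (fderiv ℝ F x) v| := by congr 1; ring
    _ ≤ C * ‖v‖ ^ 2 * ‖v‖ := h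
    _ = C * ‖v‖ ^ 3 := by ring

/-- A function with nonnegative mixed second differences in the directions `a`, `b` has a
nonnegative mixed second derivative. -/
lemma BoundedC3.fderiv_fderiv_nonneg {F : E → ℝ} (hF : BoundedC3 F) {a b : E}
    (hab : ∀ x, ∀ s : ℝ, 0 ≤ s → F (x + s • a) + F (x + s • b) ≤ F (x + s • a + s • b) + F x) (x : E) :
    0 ≤ fderiv ℝ (fderiv ℝ F) x a b := by
  obtain ⟨C, hC0, hC⟩ := hF.exists_taylor
  have hsymm : fderiv ℝ (fderiv ℝ F) x b a = fderiv ℝ (fderiv ℝ F) x a b :=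
    hF.1.contDiffAt.isSymmSndFDerivAt (by simp; norm_num) b a
  set B := fderiv ℝ (fderiv ℝ F) x
  set K := C * ‖a + b‖ ^ 3 + C * ‖a‖ ^ 3 + C * ‖b‖ ^ 3
  -- In the mixed difference at scale `s` the first-order and diagonal terms cancel. What remains is
  -- `s² B a b` up to `K s³`.
  have key : ∀ s : ℝ, 0 < s → -(K * s) ≤ B a b := by
    intro s hs
    have h1 := hC x (s • (a + b))
    have h2 := hC x (s • a)
    have h3 := hC x (s • b)
    have h4 := hab x s hs.le
    rw [add_assoc, ← smul_add] at h4
    simp only [norm_smul, Real.norm_eq_abs, abs_of_pos hs, map_smul, map_add,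
      _root_.smul_apply, _root_.add_apply, smul_eq_mul] at h1 h2 h3
    change |F (x + s • (a + b)) - F x - _ - 1 / 2 * (s * (s * ((B a) a + (B b) a)
      + s * ((B a) b + (B b) b)))| ≤ _ at h1
    rw [hsymm] at h1
    have h1 := (abs_le.1 h1).2
    have h2 := (abs_le.1 h2).1
    have h3 := (abs_le.1 h3).1
    have : -(K * s) * s ^ 2 ≤ B a b * s ^ 2 := by
      simp only [K]; ring_nf at *; linarith
    exact le_of_mul_le_mul_right this (by positivity)
  by_contra! hneg
  have hK : 0 ≤ K := by positivity
  -- This `s` makes `K s ≤ -(B a b) / 2`; `K + 1` avoids division by zero.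
  have := key (-(B a b) / (2 * (K + 1))) (by apply div_pos <;> linarith)
  have h5 : K * (-(B a b) / (2 * (K + 1))) ≤ -(B a b) / 2 := by
    rw [mul_div_assoc', div_le_div_iff₀ (by positivity) (by positivity)]
    nlinarith
  linarith

end Taylor

/-- A function on `[0, 1]` whose increments are at least `-K (t - s)^{3/2}` satisfies `Φ 0 ≤ Φ 1`. -/
lemma le_of_increment_ge {Φ : ℝ → ℝ} {K : ℝ}
    (h : ∀ s t, 0 ≤ s → s ≤ t → t ≤ 1 → -(K * ((t - s) * √(t - s))) ≤ Φ t - Φ s) : Φ 0 ≤ Φ 1 := by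
  have key : ∀ N : ℕ, -(K * √(1 / (N + 1 : ℝ))) ≤ Φ 1 - Φ 0 := by
    intro N
    have hN : (0 : ℝ) < N + 1 := by positivity
    have hs := Finset.sum_range_sub (fun k : ℕ => Φ (k / (N + 1 : ℝ))) (N + 1)
    have h1 : ((N + 1 : ℕ) : ℝ) / (N + 1 : ℝ) = 1 := by push_cast; field_simp
    simp only [h1, Nat.cast_zero, zero_div] at hs
    rw [← hs]
    -- Each of the `N + 1` equal steps loses at most `K (N + 1)^{-3/2}`, so the total loss tends to
    -- zero.
    calc -(K * √(1 / (N + 1 : ℝ)))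
        = ∑ k ∈ Finset.range (N + 1), -(K * ((1 / (N + 1 : ℝ)) * √(1 / (N + 1 : ℝ)))) := by
          rw [Finset.sum_const, Finset.card_range, nsmul_eq_mul]
          push_cast
          field_simp
      _ ≤ _ := by
          refine Finset.sum_le_sum fun k hk => ?_
          have hk' : (k : ℝ) + 1 ≤ N + 1 := by exact_mod_cast Finset.mem_range.1 hk
          have e : ((k + 1 : ℕ) : ℝ) / (N + 1 : ℝ) - k / (N + 1 : ℝ) = 1 / (N + 1 : ℝ) := by
            push_cast; ring
          have := h (k / (N + 1 : ℝ)) ((k + 1 : ℕ) / (N + 1 : ℝ)) (by positivity)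
            (by gcongr; simp) (by rw [div_le_one hN]; push_cast; exact hk')
          rwa [e] at this
  have hlim : Tendsto (fun N : ℕ => -(K * √(1 / (N + 1 : ℝ)))) atTop (𝓝 (-(K * √0))) :=
    (((Real.continuous_sqrt.tendsto 0).comp
      tendsto_one_div_add_atTop_nhds_zero_nat).const_mul K).neg
  have := le_of_tendsto' hlim key
  simp at this
  linarith

/-! ### Interpolation between centred Gaussian laws -/

section Scale

variable {E : Type*} [NormedAddCommGroup E] [NormedSpace ℝ E] [MeasurableSpace E]

/-- The law of `√t X` when `X` has law `μ`. -/
noncomputable def sqrtScale (μ : Measure E) (t : ℝ) : Measure E := μ.map (fun x => √t • x)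

lemma sqrtScale_one (μ : Measure E) : sqrtScale μ 1 = μ := by
  simp [sqrtScale]

lemma sqrtScale_zero (μ : Measure E) [IsProbabilityMeasure μ] :
    sqrtScale μ 0 = Measure.dirac 0 := by
  simp [sqrtScale]

variable [BorelSpace E]

instance (μ : Measure E) [IsProbabilityMeasure μ] (t : ℝ) :
    IsProbabilityMeasure (sqrtScale μ t) :=
  Measure.isProbabilityMeasure_map (by fun_prop)

lemma charFunDual_sqrtScale (μ : Measure E) [IsGaussian μ]
    (hμ : ∀ L : StrongDual ℝ E, ∫ x, L x ∂μ = 0) {t : ℝ} (ht : 0 ≤ t) (L : StrongDual ℝ E) :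
    charFunDual (sqrtScale μ t) L = Complex.exp (-(t * Var[L; μ] / 2 : ℝ)) := by
  have h : sqrtScale μ t = μ.map ((√t) • ContinuousLinearMap.id ℝ E) := rfl
  have h2 : L.comp ((√t) • ContinuousLinearMap.id ℝ E) = (√t) • L := by ext; simp
  rw [h, charFunDual_map, h2, IsGaussian.charFunDual_eq, integral_complex_ofReal, hμ]
  have h3 : Var[⇑(√t • L); μ] = t * Var[L; μ] := by
    have := variance_const_mul (√t) (⇑L) μ
    rw [Real.sq_sqrt ht] at this
    exact this
  rw [h3]
  congr 1
  push_cast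
  ring

variable [CompleteSpace E] [SecondCountableTopology E]

/-- The exponent of the characteristic function is linear in `t`. This semigroup property lets the
interpolation be studied through increments, without differentiating under the integral. -/
lemma sqrtScale_conv_sqrtScale (μ : Measure E) [IsGaussian μ]
    (hμ : ∀ L : StrongDual ℝ E, ∫ x, L x ∂μ = 0) {s t : ℝ} (hs : 0 ≤ s) (ht : 0 ≤ t) :
    sqrtScale μ s ∗ sqrtScale μ t = sqrtScale μ (s + t) := by
  refine Measure.ext_of_charFunDual ?_
  ext L
  rw [charFunDual_conv, charFunDual_sqrtScale μ hμ hs, charFunDual_sqrtScale μ hμ ht,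
    charFunDual_sqrtScale μ hμ (add_nonneg hs ht), ← Complex.exp_add]
  congr 1
  push_cast
  ring

/-- Second-order expansion of the expectation of a smooth function of a small centred random
vector. -/
lemma abs_integral_sqrtScale_sub_le {F : E → ℝ} (hF : BoundedC3 F) {C : ℝ}
    (hC : ∀ x v : E, |F (x + v) - F x - fderiv ℝ F x v
      - (1 / 2) * fderiv ℝ (fderiv ℝ F) x v v| ≤ C * ‖v‖ ^ 3)
    (μ : Measure E) [IsGaussian μ] (hμ : ∀ L : StrongDual ℝ E, ∫ x, L x ∂μ = 0)
    {t : ℝ} (ht : 0 ≤ t) (x : E) :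
    |∫ y, F (x + y) ∂(sqrtScale μ t) - F x
      - t / 2 * ∫ y, fderiv ℝ (fderiv ℝ F) x y y ∂μ| ≤ C * (∫ y, ‖y‖ ^ 3 ∂μ) * (t * √t) := by
  obtain ⟨M, hM⟩ := hF.exists_bound
  have hcont : Continuous F := hF.1.continuous
  set B := fderiv ℝ (fderiv ℝ F) x
  set G := fderiv ℝ F x
  have h3 : Integrable (fun y : E => ‖y‖ ^ 3) μ := by
    have := (IsGaussian.memLp_id μ 3 (by norm_num)).integrable_norm_pow (by norm_num)
    simpa using this
  have h2 : Integrable (fun y : E => ‖y‖ ^ 2) μ := by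
    have := (IsGaussian.memLp_id μ 2 (by norm_num)).integrable_norm_pow (by norm_num)
    simpa using this
  have hBint : Integrable (fun y => B y y) μ := by
    refine (h2.const_mul ‖B‖).mono' (by fun_prop) (ae_of_all _ fun y => ?_)
    calc ‖B y y‖ ≤ ‖B‖ * ‖y‖ * ‖y‖ := B.le_opNorm₂ y y
      _ = ‖B‖ * ‖y‖ ^ 2 := by ring
  have hGint : Integrable (fun y => G y) μ := IsGaussian.integrable_dual μ G
  have hFint : Integrable (fun y => F (x + √t • y)) μ :=
    Integrable.of_bound (by fun_prop) M (ae_of_all _ fun y => hM _)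
  have e1 : ∫ y, F (x + y) ∂(sqrtScale μ t) = ∫ y, F (x + √t • y) ∂μ :=
    integral_map (by fun_prop) (by fun_prop)
  -- The first-order term integrates to zero because `μ` is centred.
  have e2 : ∫ y, F (x + y) ∂(sqrtScale μ t) - F x - t / 2 * ∫ y, B y y ∂μ
      = ∫ y, (F (x + √t • y) - F x - √t * G y - t / 2 * B y y) ∂μ := by
    have i1 : Integrable (fun y => F (x + √t • y) - F x) μ := hFint.sub (integrable_const _)
    have i2 : Integrable (fun y => F (x + √t • y) - F x - √t * G y) μ :=
      i1.sub (hGint.const_mul _)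
    rw [integral_sub i2 (hBint.const_mul _), integral_sub i1 (hGint.const_mul _),
      integral_sub hFint (integrable_const _), e1, integral_const_mul, integral_const_mul, hμ G]
    simp
  rw [e2, ← Real.norm_eq_abs]
  refine (norm_integral_le_of_norm_le ((h3.const_mul (C * (t * √t)))) (ae_of_all _ fun y => ?_)).trans
    (le_of_eq ?_)
  · have h := hC x (√t • y)
    have e : (1 / 2 : ℝ) * B (√t • y) (√t • y) = t / 2 * B y y := by
      simp only [map_smul, _root_.smul_apply, smul_eq_mul]
      rw [← mul_assoc, ← mul_assoc, mul_assoc (1 / 2 : ℝ), Real.mul_self_sqrt ht]; ring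
    have e' : ‖√t • y‖ ^ 3 = t * √t * ‖y‖ ^ 3 := by
      rw [norm_smul, Real.norm_eq_abs, abs_of_nonneg (Real.sqrt_nonneg t), mul_pow]
      congr 1
      calc √t ^ 3 = √t * √t * √t := by ring
        _ = t * √t := by rw [Real.mul_self_sqrt ht]
    rw [e, e', map_smul, smul_eq_mul] at h
    rw [Real.norm_eq_abs]
    calc _ ≤ _ := h
      _ = _ := by ring
  · rw [integral_const_mul]; ring

/-- Comparison of Gaussian expectations by interpolation of the covariances. -/
lemma integral_le_integral_of_hessian {F : E → ℝ} (hF : BoundedC3 F)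
    (μ ν : Measure E) [IsGaussian μ] [IsGaussian ν]
    (hμ : ∀ L : StrongDual ℝ E, ∫ x, L x ∂μ = 0) (hν : ∀ L : StrongDual ℝ E, ∫ x, L x ∂ν = 0)
    (h : ∀ x, ∫ y, fderiv ℝ (fderiv ℝ F) x y y ∂ν ≤ ∫ y, fderiv ℝ (fderiv ℝ F) x y y ∂μ) :
    ∫ x, F x ∂ν ≤ ∫ x, F x ∂μ := by
  obtain ⟨C, hC0, hC⟩ := hF.exists_taylor
  obtain ⟨M, hM⟩ := hF.exists_bound
  have hcont : Continuous F := hF.1.continuous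
  have hint : ∀ (ρ : Measure E) [IsProbabilityMeasure ρ], Integrable F ρ := fun ρ _ =>
    Integrable.of_bound (by fun_prop) M (ae_of_all _ hM)
  set K := C * (∫ y, ‖y‖ ^ 3 ∂μ) + C * (∫ y, ‖y‖ ^ 3 ∂ν)
  have hstep : ∀ r : ℝ, 0 ≤ r → ∀ x, -(K * (r * √r)) ≤
      ∫ y, F (x + y) ∂(sqrtScale μ r) - ∫ y, F (x + y) ∂(sqrtScale ν r) := by
    intro r hr x
    have h1 := (abs_le.1 (abs_integral_sqrtScale_sub_le hF hC μ hμ hr x)).1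
    have h2 := (abs_le.1 (abs_integral_sqrtScale_sub_le hF hC ν hν hr x)).2
    have h3 := mul_le_mul_of_nonneg_left (h x) (by positivity : 0 ≤ r / 2)
    simp only [K]
    linarith
  -- The interpolating law is that of `√t X + √(1 - t) Y` with independent `X ∼ μ` and `Y ∼ ν`.
  -- Between times `s` and `t`, an independent summand of law `sqrtScale ν (t - s)` is replaced by
  -- one of law `sqrtScale μ (t - s)`; the rest, `ρ`, is common.
  have key := le_of_increment_ge (Φ := fun t => ∫ x, F x ∂(sqrtScale μ t ∗ sqrtScale ν (1 - t)))
    (K := K) ?_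
  · simpa [sqrtScale_one, sqrtScale_zero] using key
  intro s t hs hst ht
  set ρ := sqrtScale μ s ∗ sqrtScale ν (1 - t)
  have e1 : sqrtScale μ t ∗ sqrtScale ν (1 - t) = ρ ∗ sqrtScale μ (t - s) := by
    have : sqrtScale μ t = sqrtScale μ s ∗ sqrtScale μ (t - s) := by
      rw [sqrtScale_conv_sqrtScale μ hμ hs (by linarith)]; congr 1; ring
    rw [this, Measure.conv_assoc, Measure.conv_comm (sqrtScale μ (t - s)), ← Measure.conv_assoc]
  have e2 : sqrtScale μ s ∗ sqrtScale ν (1 - s) = ρ ∗ sqrtScale ν (t - s) := by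
    have : sqrtScale ν (1 - s) = sqrtScale ν (1 - t) ∗ sqrtScale ν (t - s) := by
      rw [sqrtScale_conv_sqrtScale ν hν (by linarith) (by linarith)]; congr 1; ring
    rw [this, ← Measure.conv_assoc]
  have hI : ∀ (τ : Measure E) [IsProbabilityMeasure τ],
      Integrable (fun x => ∫ y, F (x + y) ∂τ) ρ := by
    intro τ _
    have : Integrable (fun z : E × E => F (z.1 + z.2)) (ρ.prod τ) :=
      Integrable.of_bound (by fun_prop) M (ae_of_all _ fun _ => hM _)
    exact this.integral_prod_left
  rw [e1, e2, integral_conv (hint _), integral_conv (hint _), ← integral_sub (hI _) (hI _)]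
  calc -(K * ((t - s) * √(t - s))) = ∫ _, -(K * ((t - s) * √(t - s))) ∂ρ := by simp
    _ ≤ _ := integral_mono (integrable_const _) ((hI _).sub (hI _))
        fun x => hstep (t - s) (by linarith) x

end Scale

/-! ### The Hessian criterion in coordinates -/

section Pi

variable {ι : Type*} [Fintype ι] [DecidableEq ι]

lemma integral_dual_pi_eq_zero (μ : Measure (ι → ℝ)) [IsGaussian μ] (hμ : ∀ k, ∫ x, x k ∂μ = 0)
    (L : StrongDual ℝ (ι → ℝ)) : ∫ x, L x ∂μ = 0 := by
  have e : ∀ x, L x = ∑ k, x k * L (Pi.single k 1) := fun x => by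
    conv_lhs => rw [pi_eq_sum_univ' x]
    rw [map_sum]
    exact Finset.sum_congr rfl fun k _ => by rw [map_smul, smul_eq_mul]
  rw [integral_congr_ae (ae_of_all _ e), integral_finsetSum]
  · simp [integral_mul_const, hμ]
  · intro k _
    exact (IsGaussian.integrable_dual μ (ContinuousLinearMap.proj (R := ℝ) (φ := fun _ : ι => ℝ) k)).mul_const _

/-- Comparison of expectations of centred Gaussian vectors: `∫ F dν ≤ ∫ F dμ` if each covariance
either agrees or increases from `ν` to `μ` in a pair of directions in which `F` has nonnegative
mixed differences. -/
lemma integral_le_integral_of_covariance_le {F : (ι → ℝ) → ℝ} (hF : BoundedC3 F)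
    (μ ν : Measure (ι → ℝ)) [IsGaussian μ] [IsGaussian ν]
    (hμ : ∀ k, ∫ x, x k ∂μ = 0) (hν : ∀ k, ∫ x, x k ∂ν = 0)
    (h : ∀ k l, ∫ x, x k * x l ∂ν = ∫ x, x k * x l ∂μ ∨
      (∫ x, x k * x l ∂ν ≤ ∫ x, x k * x l ∂μ ∧ ∀ x, ∀ s : ℝ, 0 ≤ s →
        F (x + s • Pi.single k 1) + F (x + s • Pi.single l 1)
          ≤ F (x + s • Pi.single k 1 + s • Pi.single l 1) + F x)) :
    ∫ x, F x ∂ν ≤ ∫ x, F x ∂μ := by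
  refine integral_le_integral_of_hessian hF μ ν (integral_dual_pi_eq_zero μ hμ)
    (integral_dual_pi_eq_zero ν hν) fun x => ?_
  set B := fderiv ℝ (fderiv ℝ F) x with hB
  have e : ∀ (ρ : Measure (ι → ℝ)) [IsGaussian ρ], ∫ y, B y y ∂ρ =
      ∑ k, ∑ l, (∫ y, y k * y l ∂ρ) * B (Pi.single k 1) (Pi.single l 1) := by
    intro ρ _
    have hp : ∀ k, MemLp (fun y : ι → ℝ => y k) 2 ρ := fun k =>
      IsGaussian.memLp_dual ρ (ContinuousLinearMap.proj (R := ℝ) (φ := fun _ : ι => ℝ) k) 2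
        (by norm_num)
    have e1 : ∀ y : ι → ℝ, B y y =
        ∑ k, ∑ l, (y k * y l) * B (Pi.single k 1) (Pi.single l 1) := by
      intro y
      conv_lhs => rw [pi_eq_sum_univ' y]
      simp only [map_sum, map_smul, _root_.sum_apply, _root_.smul_apply, smul_eq_mul,
        Finset.mul_sum]
      rw [Finset.sum_comm]
      refine Finset.sum_congr rfl fun k _ => Finset.sum_congr rfl fun l _ => by ring
    have hi : ∀ k l, Integrable (fun y : ι → ℝ => y k * y l * B (Pi.single k 1) (Pi.single l 1)) ρ :=
      fun k l => ((hp k).integrable_mul (hp l)).mul_const _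
    simp_rw [e1]
    rw [integral_finsetSum _ fun k _ => integrable_finsetSum _ fun l _ => hi k l]
    refine Finset.sum_congr rfl fun k _ => ?_
    rw [integral_finsetSum _ fun l _ => hi k l]
    exact Finset.sum_congr rfl fun l _ => integral_mul_const _ _
  rw [e, e]
  refine Finset.sum_le_sum fun k _ => Finset.sum_le_sum fun l _ => ?_
  rcases h k l with h1 | ⟨h1, h2⟩
  · rw [h1]
  · exact mul_le_mul_of_nonneg_right h1 (hF.fderiv_fderiv_nonneg h2 x)

end Pi

/-! ### Smooth cut-offs -/

/-- A `C³` function on the line which is constant near both infinities has bounded derivatives. -/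
lemma boundedC3_of_eventually_const {g : ℝ → ℝ} (hg : ContDiff ℝ 3 g) {u v c d : ℝ}
    (hu : ∀ x < u, g x = c) (hv : ∀ x > v, g x = d) : BoundedC3 g := by
  refine ⟨hg, ?_⟩
  have key : ∀ k : ℕ, ∃ C, k ≤ 3 → ∀ x, ‖iteratedFDeriv ℝ k g x‖ ≤ C := by
    intro k
    by_cases hk : k ≤ 3
    swap
    · exact ⟨0, fun h => absurd h hk⟩
    have hcont : Continuous (iteratedFDeriv ℝ k g) :=
      hg.continuous_iteratedFDeriv (by exact_mod_cast hk)
    obtain ⟨C, hC⟩ := (isCompact_Icc (a := u) (b := v)).exists_bound_of_continuousOn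
      hcont.continuousOn
    obtain ⟨C₁, hC₁⟩ := (boundedC3_const (E := ℝ) c).2
    obtain ⟨C₂, hC₂⟩ := (boundedC3_const (E := ℝ) d).2
    refine ⟨max C (max C₁ C₂), fun _ x => ?_⟩
    rcases lt_or_ge x u with h1 | h1
    · have : g =ᶠ[𝓝 x] fun _ => c := by
        filter_upwards [Iio_mem_nhds h1] with y hy using hu y hy
      rw [(this.iteratedFDeriv ℝ k).eq_of_nhds]
      exact (hC₁ k hk x).trans ((le_max_left _ _).trans (le_max_right _ _))
    rcases lt_or_ge v x with h2 | h2
    · have : g =ᶠ[𝓝 x] fun _ => d := by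
        filter_upwards [Ioi_mem_nhds h2] with y hy using hv y hy
      rw [(this.iteratedFDeriv ℝ k).eq_of_nhds]
      exact (hC₂ k hk x).trans ((le_max_right _ _).trans (le_max_right _ _))
    · exact (hC x ⟨h1, h2⟩).trans (le_max_left _ _)
  choose C hC using key
  refine ⟨∑ k ∈ Finset.range 4, |C k|, fun k hk x => (hC k hk x).trans ?_⟩
  exact (le_abs_self _).trans (Finset.single_le_sum (f := fun k => |C k|)
    (fun _ _ => abs_nonneg _) (Finset.mem_range.2 (by omega)))

lemma boundedC3_smoothTransition_add (d : ℝ) :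
    BoundedC3 (fun x => Real.smoothTransition (x + d)) := by
  refine boundedC3_of_eventually_const (u := -d) (v := 1 - d) (c := 0) (d := 1) ?_ ?_ ?_
  · exact (Real.smoothTransition.contDiff (n := 3)).comp (contDiff_id.add contDiff_const)
  · intro x hx
    exact Real.smoothTransition.zero_of_nonpos (by linarith)
  · intro x hx
    exact Real.smoothTransition.one_of_one_le (by linarith)

/-- A smooth monotone function of `x` that vanishes for `x ≤ a` and equals one for `x ≥ b`. -/
noncomputable def smoothStep (a b x : ℝ) : ℝ := Real.smoothTransition ((x - a) / (b - a))

lemma smoothStep_nonneg (a b x : ℝ) : 0 ≤ smoothStep a b x := Real.smoothTransition.nonneg _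

lemma smoothStep_le_one (a b x : ℝ) : smoothStep a b x ≤ 1 := Real.smoothTransition.le_one _

lemma smoothStep_monotone {a b : ℝ} (hab : a < b) : Monotone (smoothStep a b) := fun x y hxy =>
  Real.smoothTransition.monotone (div_le_div_of_nonneg_right (by linarith) (by linarith))

lemma smoothStep_eq_zero {a b x : ℝ} (hab : a < b) (hx : x ≤ a) : smoothStep a b x = 0 :=
  Real.smoothTransition.zero_of_nonpos (div_nonpos_of_nonpos_of_nonneg (by linarith) (by linarith))

lemma smoothStep_eq_one {a b x : ℝ} (hab : a < b) (hx : b ≤ x) : smoothStep a b x = 1 :=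
  Real.smoothTransition.one_of_one_le ((one_le_div (by linarith)).2 (by linarith))

lemma boundedC3_smoothStep_clm {E : Type*} [NormedAddCommGroup E] [NormedSpace ℝ E] (a b τ : ℝ)
    (L : E →L[ℝ] ℝ) : BoundedC3 (fun x => smoothStep a b (L x + τ)) := by
  have := (boundedC3_smoothTransition_add ((τ - a) / (b - a))).comp_clm ((b - a)⁻¹ • L)
  convert this using 3 with x
  simp [smoothStep, div_eq_inv_mul]
  ring_nf

/-! ### Gordon's inequality for finite families -/

section Gordon

variable {I J : Type*} [Fintype I] [Fintype J] [DecidableEq I] [DecidableEq J]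

/-- The smooth approximation of the indicator of `∀ i, ∃ j, a < x (i, j) + τ (i, j)`. -/
noncomputable def gordonFun (a b : ℝ) (τ : I × J → ℝ) (x : I × J → ℝ) : ℝ :=
  ∏ i, (1 - ∏ j, (1 - smoothStep a b (x (i, j) + τ (i, j))))

omit [DecidableEq I] [DecidableEq J] in
lemma boundedC3_gordonFun (a b : ℝ) (τ : I × J → ℝ) : BoundedC3 (gordonFun a b τ) := by
  refine BoundedC3.prod _ fun i => BoundedC3.const_sub (BoundedC3.prod _ fun j =>
    BoundedC3.const_sub ?_ _) _
  exact boundedC3_smoothStep_clm a b (τ (i, j))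
    (ContinuousLinearMap.proj (R := ℝ) (φ := fun _ : I × J => ℝ) (i, j))

omit [Fintype I] [DecidableEq I] [DecidableEq J] in
lemma gordonRow_nonneg (a b : ℝ) (τ x : I × J → ℝ) (i : I) :
    0 ≤ 1 - ∏ j, (1 - smoothStep a b (x (i, j) + τ (i, j))) :=
  sub_nonneg.2 (Finset.prod_le_one
    (fun _ _ => sub_nonneg.2 (smoothStep_le_one _ _ _))
    (fun _ _ => sub_le_self _ (smoothStep_nonneg _ _ _)))

omit [Fintype I] [DecidableEq I] [DecidableEq J] in
lemma gordonRow_le_one (a b : ℝ) (τ x : I × J → ℝ) (i : I) :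
    1 - ∏ j, (1 - smoothStep a b (x (i, j) + τ (i, j))) ≤ 1 :=
  sub_le_self _ (Finset.prod_nonneg fun _ _ => sub_nonneg.2 (smoothStep_le_one _ _ _))

omit [Fintype I] [DecidableEq I] [DecidableEq J] in
lemma gordonRow_mono {a b : ℝ} (hab : a < b) (τ : I × J → ℝ) {x y : I × J → ℝ} (hxy : x ≤ y)
    (i : I) : 1 - ∏ j, (1 - smoothStep a b (x (i, j) + τ (i, j)))
      ≤ 1 - ∏ j, (1 - smoothStep a b (y (i, j) + τ (i, j))) := by
  refine sub_le_sub_left (Finset.prod_le_prod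
    (fun _ _ => sub_nonneg.2 (smoothStep_le_one _ _ _)) fun j _ => ?_) _
  exact sub_le_sub_left (smoothStep_monotone hab (by linarith [hxy (i, j)])) _

/-- The entries `k` and `l` lie in different rows, so each affects a single factor of the product
over rows. The mixed difference factors as (increment of row `k.1`) × (increment of row `l.1`) ×
(the other rows), and all three are nonnegative. Entries in one row need no sign, as their
covariances agree. -/
lemma gordonFun_supermodular {a b : ℝ} (hab : a < b) (τ : I × J → ℝ) {k l : I × J}
    (hkl : k.1 ≠ l.1) (x : I × J → ℝ) (s : ℝ) (hs : 0 ≤ s) :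
    gordonFun a b τ (x + s • Pi.single k 1) + gordonFun a b τ (x + s • Pi.single l 1)
      ≤ gordonFun a b τ (x + s • Pi.single k 1 + s • Pi.single l 1) + gordonFun a b τ x := by
  set R : I → (I × J → ℝ) → ℝ := fun i y =>
    1 - ∏ j, (1 - smoothStep a b (y (i, j) + τ (i, j))) with hR
  set y := x + s • Pi.single k (1 : ℝ) with hy
  set z := x + s • Pi.single l (1 : ℝ) with hz
  set w := y + s • Pi.single l (1 : ℝ) with hw
  have hcongr : ∀ {i : I} {u v : I × J → ℝ}, (∀ j, u (i, j) = v (i, j)) → R i u = R i v :=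
    fun {i u v} h => by simp only [hR, h]
  have hne : ∀ {m : I × J} {i : I}, i ≠ m.1 → ∀ j, (Pi.single m (1 : ℝ) : I × J → ℝ) (i, j) = 0 :=
    fun {m i} h j => Pi.single_eq_of_ne (fun e => h (by rw [← e])) _
  have hyx : ∀ i, i ≠ k.1 → R i y = R i x := fun i hi => hcongr fun j => by simp [hy, hne hi]
  have hzx : ∀ i, i ≠ l.1 → R i z = R i x := fun i hi => hcongr fun j => by simp [hz, hne hi]
  have hwy : ∀ i, i ≠ l.1 → R i w = R i y := fun i hi => hcongr fun j => by simp [hw, hne hi]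
  have hwz : ∀ i, i ≠ k.1 → R i w = R i z := fun i hi => hcongr fun j => by
    simp [hw, hy, hz, hne hi]
  have hsplit : ∀ u, gordonFun a b τ u
      = R k.1 u * (R l.1 u * ∏ i ∈ (Finset.univ.erase k.1).erase l.1, R i u) := by
    intro u
    rw [Finset.mul_prod_erase _ (fun i => R i u) (by simp [hkl.symm]),
      Finset.mul_prod_erase _ (fun i => R i u) (by simp)]
    rfl
  have hrest : ∀ u, (∀ i, i ≠ k.1 → i ≠ l.1 → R i u = R i x) →
      ∏ i ∈ (Finset.univ.erase k.1).erase l.1, R i u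
        = ∏ i ∈ (Finset.univ.erase k.1).erase l.1, R i x := fun u h =>
    Finset.prod_congr rfl fun i hi => by
      simp only [Finset.mem_erase] at hi
      exact h i hi.2.1 hi.1
  rw [hsplit y, hsplit z, hsplit w, hsplit x, hrest y fun i h _ => hyx i h,
    hrest z fun i _ h => hzx i h, hrest w fun i h h' => (hwy i h').trans (hyx i h),
    hwy k.1 hkl, hwz l.1 hkl.symm, hyx l.1 hkl.symm, hzx k.1 hkl]
  set Q := ∏ i ∈ (Finset.univ.erase k.1).erase l.1, R i x
  have hQ : 0 ≤ Q := Finset.prod_nonneg fun i _ => gordonRow_nonneg a b τ x i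
  have hpos : ∀ m : I × J, x ≤ x + s • Pi.single m (1 : ℝ) := fun m =>
    le_add_of_nonneg_right (smul_nonneg hs (Pi.single_nonneg.2 zero_le_one))
  have h1 : R k.1 x ≤ R k.1 y := gordonRow_mono hab τ (hpos k) _
  have h2 : R l.1 x ≤ R l.1 z := gordonRow_mono hab τ (hpos l) _
  have := mul_nonneg (mul_nonneg (sub_nonneg.2 h1) (sub_nonneg.2 h2)) hQ
  nlinarith

omit [DecidableEq I] [DecidableEq J] in
lemma gordonFun_mem_Icc (a b : ℝ) (τ x : I × J → ℝ) : gordonFun a b τ x ∈ Set.Icc (0 : ℝ) 1 :=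
  ⟨Finset.prod_nonneg fun i _ => gordonRow_nonneg a b τ x i,
    Finset.prod_le_one (fun i _ => gordonRow_nonneg a b τ x i)
      fun i _ => gordonRow_le_one a b τ x i⟩

omit [DecidableEq I] [DecidableEq J] in
lemma gordonFun_eq_zero {a b : ℝ} (hab : a < b) {τ x : I × J → ℝ}
    (h : ∃ i, ∀ j, x (i, j) + τ (i, j) ≤ a) : gordonFun a b τ x = 0 := by
  obtain ⟨i, hi⟩ := h
  refine Finset.prod_eq_zero (Finset.mem_univ i) ?_
  rw [Finset.prod_eq_one fun j _ => by rw [smoothStep_eq_zero hab (hi j), sub_zero], sub_self]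

omit [DecidableEq I] [DecidableEq J] in
lemma gordonFun_eq_one {a b : ℝ} (hab : a < b) {τ x : I × J → ℝ}
    (h : ¬ ∃ i, ∀ j, x (i, j) + τ (i, j) < b) : gordonFun a b τ x = 1 := by
  push Not at h
  refine Finset.prod_eq_one fun i _ => ?_
  obtain ⟨j, hj⟩ := h i
  rw [Finset.prod_eq_zero (Finset.mem_univ j) (by rw [smoothStep_eq_one hab hj, sub_self]),
    sub_zero]

/-- **Gordon's comparison inequality** for finite families. -/
theorem gordon_finite (μ ν : Measure (I × J → ℝ)) [IsGaussian μ] [IsGaussian ν]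
    (hμ : ∀ k, ∫ x, x k ∂μ = 0) (hν : ∀ k, ∫ x, x k ∂ν = 0)
    (hle : ∀ k l, ∫ x, x k * x l ∂ν ≤ ∫ x, x k * x l ∂μ)
    (heq : ∀ k l : I × J, k.1 = l.1 → ∫ x, x k * x l ∂ν = ∫ x, x k * x l ∂μ)
    (τ : I × J → ℝ) {a b : ℝ} (hab : a < b) :
    μ {x | ∃ i, ∀ j, x (i, j) + τ (i, j) ≤ a} ≤ ν {x | ∃ i, ∀ j, x (i, j) + τ (i, j) < b} := by
  have hF := boundedC3_gordonFun a b τ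
  have hcont : Continuous (gordonFun a b τ) := hF.contDiff.continuous
  have hcmp : ∫ x, gordonFun a b τ x ∂ν ≤ ∫ x, gordonFun a b τ x ∂μ := by
    refine integral_le_integral_of_covariance_le hF μ ν hμ hν fun k l => ?_
    by_cases hkl : k.1 = l.1
    · exact Or.inl (heq k l hkl)
    · exact Or.inr ⟨hle k l, fun x s hs => gordonFun_supermodular hab τ hkl x s hs⟩
  have hint : ∀ (ρ : Measure (I × J → ℝ)) [IsProbabilityMeasure ρ],
      Integrable (gordonFun a b τ) ρ := fun ρ _ =>
    Integrable.of_bound hcont.aestronglyMeasurable 1 (ae_of_all _ fun x => by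
      rw [Real.norm_eq_abs, abs_of_nonneg (gordonFun_mem_Icc a b τ x).1]
      exact (gordonFun_mem_Icc a b τ x).2)
  have hS : MeasurableSet {x : I × J → ℝ | ∃ i, ∀ j, x (i, j) + τ (i, j) ≤ a} := by measurability
  have hT : MeasurableSet {x : I × J → ℝ | ∃ i, ∀ j, x (i, j) + τ (i, j) < b} := by measurability
  set S := {x : I × J → ℝ | ∃ i, ∀ j, x (i, j) + τ (i, j) ≤ a}
  set T := {x : I × J → ℝ | ∃ i, ∀ j, x (i, j) + τ (i, j) < b}
  -- `1 - gordonFun` lies between the indicators of `S` and `T`; the gap between `a` and `b` leaves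
  -- room for the smoothing.
  have h1 : μ.real S ≤ 1 - ∫ x, gordonFun a b τ x ∂μ := by
    rw [← integral_indicator_one hS]
    calc ∫ x, S.indicator 1 x ∂μ ≤ ∫ x, (1 - gordonFun a b τ x) ∂μ := by
          refine integral_mono ((integrable_const 1).indicator hS)
            ((integrable_const 1).sub (hint μ)) fun x => ?_
          by_cases hx : x ∈ S
          · simp [hx, gordonFun_eq_zero hab hx]
          · simp [hx, (gordonFun_mem_Icc a b τ x).2]
      _ = _ := by rw [integral_sub (integrable_const 1) (hint μ)]; simp
  have h2 : 1 - ∫ x, gordonFun a b τ x ∂ν ≤ ν.real T := by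
    rw [← integral_indicator_one hT]
    calc _ = ∫ x, (1 - gordonFun a b τ x) ∂ν := by
          rw [integral_sub (integrable_const 1) (hint ν)]; simp
      _ ≤ ∫ x, T.indicator 1 x ∂ν := by
          refine integral_mono ((integrable_const 1).sub (hint ν))
            ((integrable_const 1).indicator hT) fun x => ?_
          by_cases hx : x ∈ T
          · simp [hx, (gordonFun_mem_Icc a b τ x).1]
          · simp [hx, gordonFun_eq_one hab hx]
  rw [← ENNReal.toReal_le_toReal (measure_ne_top _ _) (measure_ne_top _ _)]
  exact h1.trans (by linarith [h2]) |>.trans h2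

end Gordon

/-- A family of real random variables, any finite subfamily of which is a centred Gaussian
vector. -/
structure IsCentredGaussianField {Ω T : Type*} [MeasurableSpace Ω] (X : Ω → T → ℝ)
    (P : Measure Ω) : Prop where
  gaussian : ∀ {κ : Type} [Fintype κ] (t : κ → T), HasGaussianLaw (fun ω k => X ω (t k)) P
  centred : ∀ t, ∫ ω, X ω t ∂P = 0

/-! ### Compactness arguments for min-max events -/

section Minimax

variable {V V' : Type*} [TopologicalSpace V] [TopologicalSpace V']

/-- The complement is the projection of a closed set along a compact factor. -/
lemma isOpen_setOf_forall_lt [CompactSpace V'] {L : V × V' → ℝ} (hL : Continuous L) (a : ℝ) :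
    IsOpen {w | ∀ u, L (w, u) < a} := by
  have : {w | ∀ u, L (w, u) < a} = (Prod.fst '' {z : V × V' | a ≤ L z})ᶜ := by
    ext w
    simp
  rw [this, isOpen_compl_iff]
  exact isClosedMap_fst_of_compactSpace _ (isClosed_le continuous_const hL)

variable [CompactSpace V]

/-- If finitely many constraints taken from a dense sequence can always be satisfied, then all
constraints can be satisfied. -/
lemma exists_forall_le_of_dense {L : V × V' → ℝ} (hL : Continuous L) {b : ℝ} {u : ℕ → V'}
    (hu : DenseRange u) (h : ∀ N, ∃ m ≥ N, ∃ w, ∀ j ≤ m, L (w, u j) ≤ b) :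
    ∃ w, ∀ v, L (w, v) ≤ b := by
  have hcl : ∀ N, IsClosed {w | ∀ j ≤ N, L (w, u j) ≤ b} := fun N => by
    simp only [Set.ofPred_forall]
    exact isClosed_iInter fun j => isClosed_iInter fun _ =>
      isClosed_le (by fun_prop) continuous_const
  -- Cantor's intersection theorem yields one `w` for the whole sequence; closedness in `v` then
  -- extends the constraint to all of `V'`.
  obtain ⟨w, hw⟩ := IsCompact.nonempty_iInter_of_sequence_nonempty_isCompact_isClosed
    (fun N => {w | ∀ j ≤ N, L (w, u j) ≤ b})
    (fun N w hw j hj => hw j (hj.trans (Nat.le_succ N)))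
    (fun N => by
      obtain ⟨m, hm, w, hw⟩ := h N
      exact ⟨w, fun j hj => hw j (hj.trans hm)⟩)
    (hcl 0).isCompact hcl
  rw [Set.mem_iInter] at hw
  refine ⟨w, fun v => ?_⟩
  have hcl' : IsClosed {v | L (w, v) ≤ b} := isClosed_le (by fun_prop) continuous_const
  have hsub : Set.range u ⊆ {v | L (w, v) ≤ b} := by
    rintro _ ⟨j, rfl⟩
    exact hw j j le_rfl
  have := hcl'.closure_subset_iff.2 hsub
  rw [hu.closure_range] at this
  exact this trivial

end Minimax

/-! ### Gordon's inequality on compact spaces -/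

section Gordon

variable {Ω Ω' : Type*} [MeasurableSpace Ω] [MeasurableSpace Ω'] {P : Measure Ω} {Q : Measure Ω'}

lemma gordon_finite_field {V V' : Type*} {X : Ω → V × V' → ℝ} {Y : Ω' → V × V' → ℝ}
    (hX : IsCentredGaussianField X P) (hY : IsCentredGaussianField Y Q)
    (hle : ∀ s t, ∫ ω, Y ω s * Y ω t ∂Q ≤ ∫ ω, X ω s * X ω t ∂P)
    (heq : ∀ w u v, ∫ ω, Y ω (w, u) * Y ω (w, v) ∂Q = ∫ ω, X ω (w, u) * X ω (w, v) ∂P)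
    (τ : V × V' → ℝ) {a b : ℝ} (hab : a < b) {I J : Type} [Fintype I] [Fintype J]
    [DecidableEq I] [DecidableEq J] (w : I → V) (u : J → V') :
    P {ω | ∃ i, ∀ j, X ω (w i, u j) + τ (w i, u j) ≤ a}
      ≤ Q {ω | ∃ i, ∀ j, Y ω (w i, u j) + τ (w i, u j) < b} := by
  have gX := hX.gaussian fun k : I × J => (w k.1, u k.2)
  have gY := hY.gaussian fun k : I × J => (w k.1, u k.2)
  have := gX.isGaussian_map
  have := gY.isGaussian_map
  have mX := gX.aemeasurable
  have mY := gY.aemeasurable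
  have key := gordon_finite (P.map (fun ω (k : I × J) => X ω (w k.1, u k.2)))
    (Q.map (fun ω (k : I × J) => Y ω (w k.1, u k.2))) ?_ ?_ ?_ ?_
    (fun k => τ (w k.1, u k.2)) hab
  · have hS : MeasurableSet {x : I × J → ℝ | ∃ i, ∀ j, x (i, j) + τ (w i, u j) ≤ a} := by
      measurability
    have hT : MeasurableSet {x : I × J → ℝ | ∃ i, ∀ j, x (i, j) + τ (w i, u j) < b} := by
      measurability
    rw [Measure.map_apply_of_aemeasurable mX hS, Measure.map_apply_of_aemeasurable mY hT] at key
    exact key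
  · intro k
    rw [integral_map mX (measurable_pi_apply k).aestronglyMeasurable]
    exact hX.centred _
  · intro k
    rw [integral_map mY (measurable_pi_apply k).aestronglyMeasurable]
    exact hY.centred _
  · intro k l
    rw [integral_map mX (by fun_prop), integral_map mY (by fun_prop)]
    exact hle _ _
  · rintro ⟨i, j⟩ ⟨i', j'⟩ hkl
    obtain rfl : i = i' := hkl
    rw [integral_map mX (by fun_prop), integral_map mY (by fun_prop)]
    exact heq _ _ _

/-- **Gordon's comparison inequality** for continuous Gaussian fields on compact spaces. -/
theorem gordon_compact {V V' : Type*} [TopologicalSpace V] [TopologicalSpace V'] [CompactSpace V]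
    [CompactSpace V'] [TopologicalSpace.SeparableSpace V] [TopologicalSpace.SeparableSpace V']
    {X : Ω → V × V' → ℝ} {Y : Ω' → V × V' → ℝ} [IsProbabilityMeasure P] [IsProbabilityMeasure Q]
    (hX : IsCentredGaussianField X P) (hY : IsCentredGaussianField Y Q)
    (cX : ∀ ω, Continuous (X ω)) (cY : ∀ ω, Continuous (Y ω))
    (hle : ∀ s t, ∫ ω, Y ω s * Y ω t ∂Q ≤ ∫ ω, X ω s * X ω t ∂P)
    (heq : ∀ w u v, ∫ ω, Y ω (w, u) * Y ω (w, v) ∂Q = ∫ ω, X ω (w, u) * X ω (w, v) ∂P)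
    {τ : V × V' → ℝ} (hτ : Continuous τ) {a b : ℝ} (hab : a < b) :
    P {ω | ∃ w, ∀ u, X ω (w, u) + τ (w, u) < a}
      ≤ Q {ω | ∃ w, ∀ u, Y ω (w, u) + τ (w, u) ≤ b} := by
  rcases isEmpty_or_nonempty V with hV | hV
  · simp
  rcases isEmpty_or_nonempty V' with hV' | hV'
  · simp
  obtain ⟨w, hw⟩ := TopologicalSpace.exists_dense_seq V
  obtain ⟨u, hu⟩ := TopologicalSpace.exists_dense_seq V'
  set A : ℕ → Set Ω := fun K => {ω | ∃ i ≤ K, ∀ v, X ω (w i, v) + τ (w i, v) < a} with hA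
  set B : ℕ → Set Ω' := fun N =>
    {ω | ∃ i : Fin (N + 1), ∀ j : Fin (N + 1), Y ω (w i, u j) + τ (w i, u j) < b} with hB
  have hAB : ∀ K N, K ≤ N → P (A K) ≤ Q (B N) := by
    intro K N hKN
    refine le_trans (measure_mono ?_) (gordon_finite_field hX hY hle heq τ hab
      (fun i : Fin (N + 1) => w i) (fun j : Fin (N + 1) => u j))
    rintro ω ⟨i, hi, h⟩
    exact ⟨⟨i, by omega⟩, fun j => (h (u j)).le⟩
  have hBm : ∀ N, NullMeasurableSet (B N) Q := by
    intro N
    have gY := (hY.gaussian fun k : Fin (N + 1) × Fin (N + 1) => (w k.1, u k.2)).aemeasurable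
    have hT : MeasurableSet {x : Fin (N + 1) × Fin (N + 1) → ℝ |
        ∃ i, ∀ j, x (i, j) + τ (w i, u j) < b} := by measurability
    exact gY.nullMeasurable hT
  have hAmono : Monotone A := fun K K' hK ω ⟨i, hi, h⟩ => ⟨i, hi.trans hK, h⟩
  -- The strict constraints define an open set of `w`, which contains a point of the dense sequence
  -- as soon as it is nonempty.
  have hEA : {ω | ∃ w, ∀ u, X ω (w, u) + τ (w, u) < a} ⊆ ⋃ K, A K := by
    rintro ω ⟨w₀, h₀⟩
    have ho := isOpen_setOf_forall_lt ((cX ω).add hτ) a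
    obtain ⟨i, hi⟩ := hw.exists_mem_open ho ⟨w₀, h₀⟩
    exact Set.mem_iUnion.2 ⟨i, i, le_rfl, hi⟩
  -- The events `B N` are not monotone: larger `N` offers more candidates `w` but imposes more
  -- constraints. Their limsup is used instead.
  set D : ℕ → Set Ω' := fun N => ⋃ m ≥ N, B m with hD
  have hDanti : Antitone D := fun N N' hN =>
    Set.iUnion₂_subset fun m hm => Set.subset_iUnion₂_of_subset m (le_trans hN hm) subset_rfl
  have hDE : ⋂ N, D N ⊆ {ω | ∃ w, ∀ u, Y ω (w, u) + τ (w, u) ≤ b} := by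
    intro ω hω
    rw [Set.mem_iInter] at hω
    refine exists_forall_le_of_dense ((cY ω).add hτ) hu fun N => ?_
    obtain ⟨m, hm, i, hi⟩ := Set.mem_iUnion₂.1 (hω N)
    exact ⟨m, hm, w i, fun j hj => (hi ⟨j, by omega⟩).le⟩
  calc P {ω | ∃ w, ∀ u, X ω (w, u) + τ (w, u) < a} ≤ P (⋃ K, A K) := measure_mono hEA
    _ = ⨆ K, P (A K) := hAmono.measure_iUnion
    _ ≤ ⨅ N, Q (D N) := by
        refine iSup_le fun K => le_iInf fun N => ?_
        refine (hAB K (max K N) (le_max_left _ _)).trans (measure_mono ?_)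
        exact Set.subset_iUnion₂_of_subset (max K N) (le_max_right _ _) subset_rfl
    _ = Q (⋂ N, D N) := (hDanti.measure_iInter
        (fun N => NullMeasurableSet.iUnion fun m => NullMeasurableSet.iUnion fun _ => hBm m)
        ⟨0, measure_ne_top _ _⟩).symm
    _ ≤ _ := measure_mono hDE

end Gordon

/-! ### Sums and covariances of centred Gaussian fields -/

section Field

variable {Ω Ω' T T' : Type*} [MeasurableSpace Ω] [MeasurableSpace Ω'] {P : Measure Ω}
  {Q : Measure Ω'} {X : Ω → T → ℝ} {Z : Ω' → T → ℝ}

lemma IsCentredGaussianField.memLp_two (hX : IsCentredGaussianField X P) (t : T) :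
    MemLp (fun ω => X ω t) 2 P := by
  have h := (hX.gaussian (fun _ : Unit => t)).map_fun
    (ContinuousLinearMap.proj (R := ℝ) (φ := fun _ : Unit => ℝ) ())
  exact h.memLp_two

lemma IsCentredGaussianField.integrable_mul (hX : IsCentredGaussianField X P) (s t : T) :
    Integrable (fun ω => X ω s * X ω t) P :=
  (hX.memLp_two s).integrable_mul (hX.memLp_two t)

lemma IsCentredGaussianField.comp (hX : IsCentredGaussianField X P) (φ : T' → T) :
    IsCentredGaussianField (fun ω t => X ω (φ t)) P where
  gaussian t := hX.gaussian fun k => φ (t k)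
  centred t := hX.centred (φ t)

lemma IsCentredGaussianField.neg (hX : IsCentredGaussianField X P) :
    IsCentredGaussianField (fun ω t => -X ω t) P where
  gaussian t := (hX.gaussian t).fun_neg
  centred t := by rw [integral_neg, hX.centred t, neg_zero]

/-- Linear functionals of a centred Gaussian vector form a centred Gaussian field. -/
lemma isCentredGaussianField_sum {ι : Type*} [Fintype ι] {G : Ω → ι → ℝ}
    (hG : HasGaussianLaw G P) (hG0 : ∀ k, ∫ ω, G ω k ∂P = 0) (a : T → ι → ℝ) :
    IsCentredGaussianField (fun ω t => ∑ k, a t k * G ω k) P where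
  gaussian {κ} _ t := by
    let L : (ι → ℝ) →L[ℝ] (κ → ℝ) := ContinuousLinearMap.pi fun i =>
      ∑ k, a (t i) k • ContinuousLinearMap.proj (R := ℝ) (φ := fun _ : ι => ℝ) k
    have e : (fun ω i => ∑ k, a (t i) k * G ω k) = fun ω => L (G ω) := by
      ext ω i
      simp [L, _root_.sum_apply]
    rw [e]
    exact hG.map_fun L
  centred t := by
    have hi : ∀ k, Integrable (fun ω => G ω k) P := fun k =>
      (hG.map_fun (ContinuousLinearMap.proj (R := ℝ) (φ := fun _ : ι => ℝ) k)).integrable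
    rw [integral_finsetSum _ fun k _ => (hi k).const_mul _]
    simp [integral_const_mul, hG0]

lemma integral_sum_mul_sum {ι : Type*} [Fintype ι] {G : Ω → ι → ℝ}
    (hG : HasGaussianLaw G P) (a b : ι → ℝ) :
    ∫ ω, (∑ k, a k * G ω k) * (∑ k, b k * G ω k) ∂P
      = ∑ k, ∑ l, a k * b l * ∫ ω, G ω k * G ω l ∂P := by
  have hp : ∀ k, MemLp (fun ω => G ω k) 2 P := fun k =>
    (hG.map_fun (ContinuousLinearMap.proj (R := ℝ) (φ := fun _ : ι => ℝ) k)).memLp_two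
  have hi : ∀ k l, Integrable (fun ω => a k * b l * (G ω k * G ω l)) P := fun k l =>
    ((hp k).integrable_mul (hp l)).const_mul _
  have e : ∀ ω, (∑ k, a k * G ω k) * (∑ k, b k * G ω k)
      = ∑ k, ∑ l, a k * b l * (G ω k * G ω l) := fun ω => by
    rw [Finset.sum_mul_sum]
    exact Finset.sum_congr rfl fun k _ => Finset.sum_congr rfl fun l _ => by ring
  simp_rw [e]
  rw [integral_finsetSum _ fun k _ => integrable_finsetSum _ fun l _ => hi k l]
  refine Finset.sum_congr rfl fun k _ => ?_
  rw [integral_finsetSum _ fun l _ => hi k l]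
  exact Finset.sum_congr rfl fun l _ => integral_const_mul _ _

variable [IsProbabilityMeasure P] [IsProbabilityMeasure Q]

/-- The sum of two independent centred Gaussian fields is a centred Gaussian field. -/
lemma IsCentredGaussianField.add_prod (hX : IsCentredGaussianField X P)
    (hZ : IsCentredGaussianField Z Q) :
    IsCentredGaussianField (fun (ω : Ω × Ω') t => X ω.1 t + Z ω.2 t) (P.prod Q) where
  gaussian {κ} _ t := by
    have gX := hX.gaussian t
    have gZ := hZ.gaussian t
    have mX := gX.aemeasurable
    have mZ := gZ.aemeasurable
    have := gX.isGaussian_map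
    have := gZ.isGaussian_map
    have h1 : HasGaussianLaw (fun (ω : Ω × Ω') k => X ω.1 (t k)) (P.prod Q) :=
      (HasLaw.fun_comp ⟨mX, rfl⟩ (measurePreserving_fst (μ := P) (ν := Q)).hasLaw).hasGaussianLaw
    have h2 : HasGaussianLaw (fun (ω : Ω × Ω') k => Z ω.2 (t k)) (P.prod Q) :=
      (HasLaw.fun_comp ⟨mZ, rfl⟩ (measurePreserving_snd (μ := P) (ν := Q)).hasLaw).hasGaussianLaw
    exact ((indepFun_prod₀ mX mZ).hasGaussianLaw h1 h2).fun_add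
  centred t := by
    have hX1 := (hX.memLp_two t).integrable one_le_two
    have hZ1 := (hZ.memLp_two t).integrable one_le_two
    rw [integral_add (hX1.comp_fst Q) (hZ1.comp_snd P)]
    have e1 : ∫ ω : Ω × Ω', X ω.1 t ∂(P.prod Q) = ∫ ω, X ω t ∂P := by
      simpa using integral_fun_fst (μ := P) (ν := Q) (fun ω => X ω t)
    have e2 : ∫ ω : Ω × Ω', Z ω.2 t ∂(P.prod Q) = ∫ ω, Z ω t ∂Q := by
      simpa using integral_fun_snd (μ := P) (ν := Q) (fun ω => Z ω t)
    rw [e1, e2, hX.centred, hZ.centred, add_zero]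

lemma IsCentredGaussianField.integral_add_prod_mul (hX : IsCentredGaussianField X P)
    (hZ : IsCentredGaussianField Z Q) (s t : T) :
    ∫ ω : Ω × Ω', (X ω.1 s + Z ω.2 s) * (X ω.1 t + Z ω.2 t) ∂(P.prod Q)
      = ∫ ω, X ω s * X ω t ∂P + ∫ ω, Z ω s * Z ω t ∂Q := by
  have hX1 := fun t => (hX.memLp_two t).integrable one_le_two
  have hZ1 := fun t => (hZ.memLp_two t).integrable one_le_two
  have i1 := (hX.integrable_mul s t).comp_fst Q
  have i2 := (hZ.integrable_mul s t).comp_snd P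
  have i3 := (hX1 s).mul_prod (hZ1 t)
  have i4 := (hX1 t).mul_prod (hZ1 s)
  have e : ∀ ω : Ω × Ω', (X ω.1 s + Z ω.2 s) * (X ω.1 t + Z ω.2 t)
      = (X ω.1 s * X ω.1 t + Z ω.2 s * Z ω.2 t) + (X ω.1 s * Z ω.2 t + X ω.1 t * Z ω.2 s) :=
    fun ω => by ring
  have e1 : ∫ ω : Ω × Ω', X ω.1 s * X ω.1 t ∂(P.prod Q) = ∫ ω, X ω s * X ω t ∂P := by
    simpa using integral_fun_fst (μ := P) (ν := Q) (fun ω => X ω s * X ω t)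
  have e2 : ∫ ω : Ω × Ω', Z ω.2 s * Z ω.2 t ∂(P.prod Q) = ∫ ω, Z ω s * Z ω t ∂Q := by
    simpa using integral_fun_snd (μ := P) (ν := Q) (fun ω => Z ω s * Z ω t)
  have i12 : Integrable (fun ω : Ω × Ω' => X ω.1 s * X ω.1 t + Z ω.2 s * Z ω.2 t)
    (P.prod Q) := i1.add i2
  have i34 : Integrable (fun ω : Ω × Ω' => X ω.1 s * Z ω.2 t + X ω.1 t * Z ω.2 s)
    (P.prod Q) := i3.add i4
  simp_rw [e]
  rw [integral_add i12 i34, integral_add i1 i2, integral_add i3 i4, e1, e2,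
    integral_prod_mul (fun ω => X ω s) (fun ω => Z ω t),
    integral_prod_mul (fun ω => X ω t) (fun ω => Z ω s), hX.centred, hX.centred]
  ring

end Field

/-! ### Standard Gaussian vectors -/

section StdGaussian

lemma hasGaussianLaw_of_hasLaw_pi {Ω ι : Type*} [MeasurableSpace Ω] [Fintype ι] {P : Measure Ω}
    {G : Ω → ι → ℝ} (hG : HasLaw G (Measure.pi fun _ => gaussianReal 0 1) P) :
    HasGaussianLaw G P := by
  have : IsGaussian (Measure.pi fun _ : ι => gaussianReal 0 1) := by
    have h := iIndepFun.hasGaussianLaw (P := Measure.pi fun _ : ι => gaussianReal 0 1)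
      (X := fun (i : ι) (x : ι → ℝ) => x i) (fun i => (measurePreserving_eval
        (fun _ : ι => gaussianReal 0 1) i).hasLaw.hasGaussianLaw)
      (iIndepFun_pi (X := fun _ => id) fun _ => aemeasurable_id)
    have := h.isGaussian_map
    simpa using this
  exact hG.hasGaussianLaw

lemma integral_eval_of_hasLaw_pi {Ω ι : Type*} [MeasurableSpace Ω] [Fintype ι] {P : Measure Ω}
    {G : Ω → ι → ℝ} (hG : HasLaw G (Measure.pi fun _ => gaussianReal 0 1) P) (k : ι) :
    ∫ ω, G ω k ∂P = 0 := by
  have h := (measurePreserving_eval (fun _ : ι => gaussianReal 0 1) k).hasLaw.comp hG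
  have := h.integral_eq
  rw [integral_id_gaussianReal] at this
  exact this

lemma integral_mul_of_hasLaw_pi {Ω ι : Type*} [MeasurableSpace Ω] [Fintype ι] [DecidableEq ι]
    {P : Measure Ω} {G : Ω → ι → ℝ} (hG : HasLaw G (Measure.pi fun _ => gaussianReal 0 1) P)
    (k l : ι) : ∫ ω, G ω k * G ω l ∂P = if k = l then 1 else 0 := by
  have e : ∫ ω, G ω k * G ω l ∂P
      = ∫ x : ι → ℝ, x k * x l ∂(Measure.pi fun _ => gaussianReal 0 1) :=
    hG.integral_comp (f := fun x : ι → ℝ => x k * x l) (by fun_prop)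
  rw [e]
  split_ifs with h
  · subst h
    have h1 := (measurePreserving_eval (fun _ : ι => gaussianReal 0 1) k).hasLaw.integral_comp
      (f := fun x : ℝ => x * x) (by fun_prop)
    have h2 : ∫ x, x * x ∂(gaussianReal 0 1) = 1 := by
      have := variance_id_gaussianReal (μ := 0) (v := 1)
      rw [variance_eq_integral aemeasurable_id] at this
      simpa [pow_two] using this
    rw [← h2, ← h1]
    rfl
  · have hind := iIndepFun_pi (μ := fun _ : ι => gaussianReal 0 1) (X := fun _ => id)
      fun _ => aemeasurable_id
    have h1 := (hind.indepFun h).integral_fun_mul_eq_mul_integral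
      (measurable_pi_apply k).aestronglyMeasurable (measurable_pi_apply l).aestronglyMeasurable
    have h2 := integral_eval_of_hasLaw_pi
      (HasLaw.id (μ := Measure.pi fun _ : ι => gaussianReal 0 1)) k
    simp only [id] at h1 h2
    rw [h1, h2, zero_mul]

/-- Lebesgue measure is absolutely continuous with respect to the Gaussian law. Positivity is all
that is needed of the constant. -/
lemma gaussianReal_Iic_ne_zero : gaussianReal 0 1 (Set.Iic 0) ≠ 0 := by
  intro h
  have h1 := gaussianReal_absolutelyContinuous' 0 (v := 1) one_ne_zero h
  simp at h1

end StdGaussian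

/-! ### Comparison with added noise -/

section Comparison

variable {Ω Ω' : Type*} [MeasurableSpace Ω] [MeasurableSpace Ω'] {P : Measure Ω} {Q : Measure Ω'}
  [IsProbabilityMeasure P] [IsProbabilityMeasure Q]

/-- Gordon's comparison, where the variances are matched by adding independent multiples of
standard Gaussian variables to the first field. -/
theorem gordon_augmented {V V' : Type*} [TopologicalSpace V] [TopologicalSpace V'] [CompactSpace V]
    [CompactSpace V'] [TopologicalSpace.SeparableSpace V] [TopologicalSpace.SeparableSpace V']
    {X : Ω → V × V' → ℝ} {Y : Ω' → V × V' → ℝ}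
    (hX : IsCentredGaussianField X P) (hY : IsCentredGaussianField Y Q)
    (cX : ∀ ω, Continuous (X ω)) (cY : ∀ ω, Continuous (Y ω))
    {M : ℕ} {r : V × V' → Fin M → ℝ} (hr : Continuous r) (hr0 : ∀ t l, 0 ≤ r t l)
    (hle : ∀ s t, ∫ ω, Y ω s * Y ω t ∂Q ≤ ∫ ω, X ω s * X ω t ∂P + ∑ l, r s l * r t l)
    (heq : ∀ w u v, ∫ ω, Y ω (w, u) * Y ω (w, v) ∂Q
      = ∫ ω, X ω (w, u) * X ω (w, v) ∂P + ∑ l, r (w, u) l * r (w, v) l)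
    {τ : V × V' → ℝ} (hτ : Continuous τ) {a b : ℝ} (hab : a < b) :
    P {ω | ∃ w, ∀ u, X ω (w, u) + τ (w, u) < a} * gaussianReal 0 1 (Set.Iic 0) ^ M
      ≤ Q {ω | ∃ w, ∀ u, Y ω (w, u) + τ (w, u) ≤ b} := by
  set γ : Measure (Fin M → ℝ) := Measure.pi fun _ => gaussianReal 0 1
  have hγ : HasLaw (fun z : Fin M → ℝ => z) γ γ := HasLaw.id
  have hZ := isCentredGaussianField_sum (hasGaussianLaw_of_hasLaw_pi hγ)
    (integral_eval_of_hasLaw_pi hγ) r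
  have hZcov : ∀ s t, ∫ z, (∑ l, r s l * z l) * (∑ l, r t l * z l) ∂γ = ∑ l, r s l * r t l := by
    intro s t
    rw [integral_sum_mul_sum (hasGaussianLaw_of_hasLaw_pi hγ)]
    simp [integral_mul_of_hasLaw_pi hγ]
  have key := gordon_compact (hX.add_prod hZ) hY
    (fun ω => (cX ω.1).add (by fun_prop)) cY
    (fun s t => by rw [hX.integral_add_prod_mul hZ, hZcov]; exact hle s t)
    (fun w u v => by rw [hX.integral_add_prod_mul hZ, hZcov]; exact heq w u v) hτ hab
  refine le_trans ?_ key
  have hpi : γ (Set.univ.pi fun _ => Set.Iic 0) = gaussianReal 0 1 (Set.Iic 0) ^ M := by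
    rw [Measure.pi_pi]
    simp
  rw [← hpi, ← Measure.prod_prod]
  -- When every `z l ≤ 0`, the noise is nonpositive because `r ≥ 0`, so the event for `X` implies
  -- the one for the augmented field.
  refine measure_mono ?_
  rintro ⟨ω, z⟩ ⟨⟨w, hw⟩, hz⟩
  refine ⟨w, fun u => lt_of_le_of_lt ?_ (hw u)⟩
  have : ∑ l, r (w, u) l * z l ≤ 0 := Finset.sum_nonpos fun l _ =>
    mul_nonpos_of_nonneg_of_nonpos (hr0 _ _) (hz l trivial)
  simp only
  linarith

end Comparison

/-! ### Seminorms of positive semi-definite matrices -/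

section Seminorm

variable {d : ℕ} {S : Matrix (Fin d) (Fin d) ℝ}

lemma sqrt_mulVec_dotProduct (S : Matrix (Fin d) (Fin d) ℝ) (v w : Fin d → ℝ) :
    (CFC.sqrt S *ᵥ v) ⬝ᵥ w = v ⬝ᵥ (CFC.sqrt S *ᵥ w) := by
  have hR : (CFC.sqrt S).IsHermitian := (CFC.sqrt_nonneg S).posSemidef.isHermitian
  have hT : (CFC.sqrt S)ᵀ = CFC.sqrt S := by
    rw [← conjTranspose_eq_transpose_of_trivial]
    exact hR
  rw [dotProduct_mulVec, ← mulVec_transpose, hT]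

lemma sqrt_mulVec_dotProduct_sqrt_mulVec (hS : S.PosSemidef) (v w : Fin d → ℝ) :
    (CFC.sqrt S *ᵥ v) ⬝ᵥ (CFC.sqrt S *ᵥ w) = v ⬝ᵥ (S *ᵥ w) := by
  rw [sqrt_mulVec_dotProduct, mulVec_mulVec, CFC.sqrt_mul_sqrt_self S hS.nonneg]

lemma wnorm_nonneg (S : Matrix (Fin d) (Fin d) ℝ) (v : Fin d → ℝ) : 0 ≤ wnorm S v :=
  Real.sqrt_nonneg _

lemma wnorm_mul_self (hS : S.PosSemidef) (v : Fin d → ℝ) :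
    wnorm S v * wnorm S v = v ⬝ᵥ (S *ᵥ v) :=
  Real.mul_self_sqrt (by simpa using hS.dotProduct_mulVec_nonneg v)

/-- Cauchy–Schwarz for the images of `v` and `w` under the square root of `S`. -/
lemma dotProduct_mulVec_le_wnorm_mul_wnorm (hS : S.PosSemidef) (v w : Fin d → ℝ) :
    v ⬝ᵥ (S *ᵥ w) ≤ wnorm S v * wnorm S w := by
  have h := Real.sum_mul_le_sqrt_mul_sqrt Finset.univ (CFC.sqrt S *ᵥ v) (CFC.sqrt S *ᵥ w)
  have e : ∀ v, ∑ i, (CFC.sqrt S *ᵥ v) i ^ 2 = v ⬝ᵥ (S *ᵥ v) := fun v => by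
    rw [← sqrt_mulVec_dotProduct_sqrt_mulVec hS]
    exact Finset.sum_congr rfl fun i _ => pow_two _
  rw [e, e] at h
  rw [← sqrt_mulVec_dotProduct_sqrt_mulVec hS]
  exact h

@[fun_prop]
lemma continuous_wnorm (S : Matrix (Fin d) (Fin d) ℝ) : Continuous (wnorm S) := by
  unfold wnorm
  fun_prop

end Seminorm

/-! ### Primary and auxiliary fields and their comparison -/

section Fields

variable {Ω : Type*} [MeasurableSpace Ω] {P : Measure Ω} {p n M : ℕ}
  {H : Ω → Matrix (Fin p) (Fin n) ℝ} {C : Fin M → Matrix (Fin p) (Fin p) ℝ}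
  {D : Fin M → Matrix (Fin n) (Fin n) ℝ} {h : Ω → Fin M → Fin n → ℝ} {g : Ω → Fin M → Fin p → ℝ}

lemma dotProduct_mulVec_eq_sum_prod (A : Matrix (Fin p) (Fin n) ℝ) (w : Fin p → ℝ)
    (u : Fin n → ℝ) :
    w ⬝ᵥ (A *ᵥ u) = ∑ k : Fin p × Fin n, (w k.1 * u k.2) * A k.1 k.2 := by
  rw [Fintype.sum_prod_type]
  simp only [dotProduct, mulVec, Finset.mul_sum]
  exact Finset.sum_congr rfl fun i _ => Finset.sum_congr rfl fun j _ => by ring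

lemma IsLowRankGaussian.isCentredGaussianField (hH : IsLowRankGaussian P H C D) :
    IsCentredGaussianField
      (fun ω (t : (Fin p → ℝ) × (Fin n → ℝ)) => t.1 ⬝ᵥ (H ω *ᵥ t.2)) P := by
  simp_rw [dotProduct_mulVec_eq_sum_prod]
  exact isCentredGaussianField_sum hH.gaussian (fun k => hH.centred _ _)
    (fun (t : (Fin p → ℝ) × (Fin n → ℝ)) k => t.1 k.1 * t.2 k.2)

lemma IsLowRankGaussian.integral_mul [IsProbabilityMeasure P] (hH : IsLowRankGaussian P H C D)
    (w w' : Fin p → ℝ) (u u' : Fin n → ℝ) :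
    ∫ ω, (w ⬝ᵥ (H ω *ᵥ u)) * (w' ⬝ᵥ (H ω *ᵥ u')) ∂P
      = ∑ l, (w ⬝ᵥ (C l *ᵥ w')) * (u ⬝ᵥ (D l *ᵥ u')) := by
  have hcov : ∀ k m : Fin p × Fin n, ∫ ω, H ω k.1 k.2 * H ω m.1 m.2 ∂P
      = ∑ l, C l k.1 m.1 * D l k.2 m.2 := by
    intro k m
    have hp : ∀ k : Fin p × Fin n, MemLp (fun ω => H ω k.1 k.2) 2 P := fun k =>
      (hH.gaussian.map_fun
        (ContinuousLinearMap.proj (R := ℝ) (φ := fun _ : Fin p × Fin n => ℝ) k)).memLp_two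
    have := covariance_eq_sub (hp k) (hp m)
    rw [hH.covariance_eq, hH.centred, zero_mul, sub_zero] at this
    exact this.symm
  simp_rw [dotProduct_mulVec_eq_sum_prod (H _)]
  rw [integral_sum_mul_sum hH.gaussian]
  simp_rw [hcov, Finset.mul_sum]
  rw [Finset.sum_congr rfl fun k _ => Finset.sum_comm, Finset.sum_comm]
  refine Finset.sum_congr rfl fun l _ => ?_
  rw [dotProduct_mulVec_eq_sum_prod, dotProduct_mulVec_eq_sum_prod, Finset.sum_mul_sum]
  simp_rw [Fintype.sum_prod_type]
  refine Finset.sum_congr rfl fun i _ => ?_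
  rw [Finset.sum_comm]
  refine Finset.sum_congr rfl fun i' _ => ?_
  exact Finset.sum_congr rfl fun j _ => Finset.sum_congr rfl fun j' _ => by ring

/-- The Gaussian part of the auxiliary loss. -/
noncomputable def auxField (C : Fin M → Matrix (Fin p) (Fin p) ℝ)
    (D : Fin M → Matrix (Fin n) (Fin n) ℝ) (h : Fin M → Fin n → ℝ) (g : Fin M → Fin p → ℝ)
    (t : (Fin p → ℝ) × (Fin n → ℝ)) : ℝ :=
  ∑ l, (wnorm (C l) t.1 * (h l ⬝ᵥ (CFC.sqrt (D l) *ᵥ t.2))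
      + (t.1 ⬝ᵥ (CFC.sqrt (C l) *ᵥ g l)) * wnorm (D l) t.2)

/-- The coefficients of the auxiliary field with respect to the standard Gaussian variables. -/
noncomputable def auxCoeff (C : Fin M → Matrix (Fin p) (Fin p) ℝ)
    (D : Fin M → Matrix (Fin n) (Fin n) ℝ) (t : (Fin p → ℝ) × (Fin n → ℝ))
    (k : Fin M × (Fin n ⊕ Fin p)) : ℝ :=
  Sum.elim (fun i => wnorm (C k.1) t.1 * (CFC.sqrt (D k.1) *ᵥ t.2) i)
    (fun j => wnorm (D k.1) t.2 * (CFC.sqrt (C k.1) *ᵥ t.1) j) k.2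

lemma auxField_eq_sum (h : Fin M → Fin n → ℝ) (g : Fin M → Fin p → ℝ)
    (t : (Fin p → ℝ) × (Fin n → ℝ)) :
    auxField C D h g t = ∑ k : Fin M × (Fin n ⊕ Fin p),
      auxCoeff C D t k * Sum.elim (h k.1) (g k.1) k.2 := by
  rw [Fintype.sum_prod_type]
  refine Finset.sum_congr rfl fun l _ => ?_
  rw [Fintype.sum_sum_type, ← sqrt_mulVec_dotProduct (C l)]
  simp only [auxCoeff, Sum.elim_inl, Sum.elim_inr, dotProduct, Finset.mul_sum, Finset.sum_mul]
  congr 1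
  · exact Finset.sum_congr rfl fun i _ => by ring
  · exact Finset.sum_congr rfl fun i _ => by ring

lemma AreIndepStdGaussian.isCentredGaussianField (hhg : AreIndepStdGaussian P h g)
    (C : Fin M → Matrix (Fin p) (Fin p) ℝ) (D : Fin M → Matrix (Fin n) (Fin n) ℝ) :
    IsCentredGaussianField (fun ω t => auxField C D (h ω) (g ω) t) P := by
  simp_rw [auxField_eq_sum]
  exact isCentredGaussianField_sum (hasGaussianLaw_of_hasLaw_pi hhg)
    (integral_eval_of_hasLaw_pi hhg) (auxCoeff C D)

lemma AreIndepStdGaussian.integral_mul (hhg : AreIndepStdGaussian P h g)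
    (hC : ∀ l, (C l).PosSemidef) (hD : ∀ l, (D l).PosSemidef)
    (s t : (Fin p → ℝ) × (Fin n → ℝ)) :
    ∫ ω, auxField C D (h ω) (g ω) s * auxField C D (h ω) (g ω) t ∂P
      = ∑ l, (wnorm (C l) s.1 * wnorm (C l) t.1 * (s.2 ⬝ᵥ (D l *ᵥ t.2))
        + wnorm (D l) s.2 * wnorm (D l) t.2 * (s.1 ⬝ᵥ (C l *ᵥ t.1))) := by
  simp_rw [auxField_eq_sum]
  rw [integral_sum_mul_sum (hasGaussianLaw_of_hasLaw_pi hhg)]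
  simp_rw [integral_mul_of_hasLaw_pi hhg]
  simp only [mul_ite, mul_one, mul_zero, Finset.sum_ite_eq, Finset.mem_univ, if_true]
  rw [Fintype.sum_prod_type]
  refine Finset.sum_congr rfl fun l _ => ?_
  rw [Fintype.sum_sum_type, ← sqrt_mulVec_dotProduct_sqrt_mulVec (hD l),
    ← sqrt_mulVec_dotProduct_sqrt_mulVec (hC l)]
  simp only [auxCoeff, Sum.elim_inl, Sum.elim_inr, dotProduct, Finset.mul_sum]
  congr 1
  · exact Finset.sum_congr rfl fun i _ => by ring
  · exact Finset.sum_congr rfl fun i _ => by ring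

variable [IsProbabilityMeasure P] (hH : IsLowRankGaussian P H C D) (hhg : AreIndepStdGaussian P h g)
include hH hhg

/-- The covariance of the auxiliary field is dominated by that of the augmented primary field. -/
lemma integral_auxField_mul_le (s t : (Fin p → ℝ) × (Fin n → ℝ)) :
    ∫ ω, auxField C D (h ω) (g ω) s * auxField C D (h ω) (g ω) t ∂P
      ≤ ∫ ω, (s.1 ⬝ᵥ (H ω *ᵥ s.2)) * (t.1 ⬝ᵥ (H ω *ᵥ t.2)) ∂P
        + ∑ l, (wnorm (C l) s.1 * wnorm (D l) s.2) * (wnorm (C l) t.1 * wnorm (D l) t.2) := by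
  rw [hhg.integral_mul hH.posSemidef_left hH.posSemidef_right, hH.integral_mul,
    ← Finset.sum_add_distrib]
  refine Finset.sum_le_sum fun l _ => ?_
  have h1 := dotProduct_mulVec_le_wnorm_mul_wnorm (hH.posSemidef_left l) s.1 t.1
  have h2 := dotProduct_mulVec_le_wnorm_mul_wnorm (hH.posSemidef_right l) s.2 t.2
  -- The right side minus the left side of the `l`-th term is exactly this product.
  have := mul_nonneg (sub_nonneg.2 h1) (sub_nonneg.2 h2)
  nlinarith

/-- With equal `w` the Cauchy–Schwarz defect in `w` vanishes. This is the equality case Gordon's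
inequality requires for the min-max. -/
lemma integral_auxField_mul_eq_of_left_eq (w : Fin p → ℝ) (u v : Fin n → ℝ) :
    ∫ ω, auxField C D (h ω) (g ω) (w, u) * auxField C D (h ω) (g ω) (w, v) ∂P
      = ∫ ω, (w ⬝ᵥ (H ω *ᵥ u)) * (w ⬝ᵥ (H ω *ᵥ v)) ∂P
        + ∑ l, (wnorm (C l) w * wnorm (D l) u) * (wnorm (C l) w * wnorm (D l) v) := by
  rw [hhg.integral_mul hH.posSemidef_left hH.posSemidef_right, hH.integral_mul,
    ← Finset.sum_add_distrib]
  refine Finset.sum_congr rfl fun l _ => ?_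
  rw [← wnorm_mul_self (hH.posSemidef_left l)]
  ring

/-- The counterpart for the max-min, where rows are indexed by `u`. -/
lemma integral_auxField_mul_eq_of_right_eq (u : Fin n → ℝ) (w v : Fin p → ℝ) :
    ∫ ω, auxField C D (h ω) (g ω) (w, u) * auxField C D (h ω) (g ω) (v, u) ∂P
      = ∫ ω, (w ⬝ᵥ (H ω *ᵥ u)) * (v ⬝ᵥ (H ω *ᵥ u)) ∂P
        + ∑ l, (wnorm (C l) w * wnorm (D l) u) * (wnorm (C l) v * wnorm (D l) u) := by
  rw [hhg.integral_mul hH.posSemidef_left hH.posSemidef_right, hH.integral_mul,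
    ← Finset.sum_add_distrib]
  refine Finset.sum_congr rfl fun l _ => ?_
  rw [← wnorm_mul_self (hH.posSemidef_right l)]
  ring

omit hH hhg in
lemma continuous_auxField (h : Fin M → Fin n → ℝ) (g : Fin M → Fin p → ℝ) :
    Continuous (auxField C D h g) := by
  unfold auxField
  fun_prop

variable {f : (Fin p → ℝ) → (Fin n → ℝ) → ℝ} {W : Set (Fin p → ℝ)} {U : Set (Fin n → ℝ)}

/-- Lower tail comparison of the primary and the auxiliary min-max problem. -/
theorem primary_minmax_lt_le (hW : IsCompact W) (hU : IsCompact U)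
    (hf : ContinuousOn (Function.uncurry f) (W ×ˢ U)) {a b : ℝ} (hab : a < b) :
    P {ω | ∃ w ∈ W, ∀ u ∈ U, primaryLoss f (H ω) w u < a} * gaussianReal 0 1 (Set.Iic 0) ^ M
      ≤ P {ω | ∃ w ∈ W, ∀ u ∈ U, auxLoss f C D (h ω) (g ω) w u ≤ b} := by
  have : CompactSpace W := isCompact_iff_compactSpace.1 hW
  have : CompactSpace U := isCompact_iff_compactSpace.1 hU
  let φ : W × U → (Fin p → ℝ) × (Fin n → ℝ) := fun z => (z.1, z.2)
  have hφ : Continuous φ := by fun_prop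
  have hτ : Continuous fun z : W × U => f z.1 z.2 :=
    hf.comp_continuous hφ fun z => ⟨z.1.2, z.2.2⟩
  have key := gordon_augmented (hH.isCentredGaussianField.comp φ)
    ((hhg.isCentredGaussianField C D).comp φ)
    (fun ω => by fun_prop) (fun ω => (continuous_auxField _ _).comp hφ)
    (r := fun z l => wnorm (C l) z.1 * wnorm (D l) z.2) (by fun_prop)
    (fun _ _ => mul_nonneg (wnorm_nonneg _ _) (wnorm_nonneg _ _))
    (fun s t => integral_auxField_mul_le hH hhg _ _)
    (fun w u v => integral_auxField_mul_eq_of_left_eq hH hhg _ _ _) hτ hab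
  refine (mul_le_mul' (measure_mono ?_) le_rfl).trans (key.trans (measure_mono ?_))
  · rintro ω ⟨w, hw, h⟩
    exact ⟨⟨w, hw⟩, fun u => h u u.2⟩
  · rintro ω ⟨w, h⟩
    exact ⟨w, w.2, fun u hu => h ⟨u, hu⟩⟩

/-- Comparison of the upper tails of the primary and the auxiliary max-min problem. -/
theorem primary_maxmin_gt_le (hW : IsCompact W) (hU : IsCompact U)
    (hf : ContinuousOn (Function.uncurry f) (W ×ˢ U)) {a b : ℝ} (hab : b < a) :
    P {ω | ∃ u ∈ U, ∀ w ∈ W, a < primaryLoss f (H ω) w u} * gaussianReal 0 1 (Set.Iic 0) ^ M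
      ≤ P {ω | ∃ u ∈ U, ∀ w ∈ W, b ≤ auxLoss f C D (h ω) (g ω) w u} := by
  have : CompactSpace W := isCompact_iff_compactSpace.1 hW
  have : CompactSpace U := isCompact_iff_compactSpace.1 hU
  let φ : U × W → (Fin p → ℝ) × (Fin n → ℝ) := fun z => (z.2, z.1)
  have hφ : Continuous φ := by fun_prop
  have hτ : Continuous fun z : U × W => -f z.2 z.1 :=
    (hf.comp_continuous hφ fun z => ⟨z.2.2, z.1.2⟩).neg
  -- Negating the fields and exchanging the variables turns the upper tail of a max-min into the
  -- lower tail of a min-max; covariances are unchanged.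
  have key := gordon_augmented (hH.isCentredGaussianField.comp φ).neg
    ((hhg.isCentredGaussianField C D).comp φ).neg
    (fun ω => by fun_prop) (fun ω => ((continuous_auxField _ _).comp hφ).neg)
    (r := fun z l => wnorm (C l) z.2 * wnorm (D l) z.1) (by fun_prop)
    (fun _ _ => mul_nonneg (wnorm_nonneg _ _) (wnorm_nonneg _ _))
    (fun s t => by
      simp only [neg_mul_neg]
      exact integral_auxField_mul_le hH hhg _ _)
    (fun w u v => by
      simp only [neg_mul_neg]
      exact integral_auxField_mul_eq_of_right_eq hH hhg _ _ _) hτ (neg_lt_neg hab)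
  simp only [← neg_add, neg_lt_neg_iff, neg_le_neg_iff] at key
  refine (mul_le_mul' (measure_mono ?_) le_rfl).trans (key.trans (measure_mono ?_))
  · rintro ω ⟨u, hu, h⟩
    exact ⟨⟨u, hu⟩, fun w => h w w.2⟩
  · rintro ω ⟨u, h⟩
    exact ⟨u, u.2, fun w hw => h ⟨w, hw⟩⟩

end Fields

/-! ### Minimax duality -/

section MinMax

variable {p n : ℕ} {L : (Fin p → ℝ) → (Fin n → ℝ) → ℝ} {W : Set (Fin p → ℝ)}
  {U : Set (Fin n → ℝ)}

lemma innerMax_le_coe_iff {w : Fin p → ℝ} {b : ℝ} :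
    innerMax L U w ≤ (b : EReal) ↔ ∀ u ∈ U, L w u ≤ b := by
  simp only [innerMax, iSup_le_iff, EReal.coe_le_coe_iff]

lemma minMax_le_of_exists {b : ℝ} (h : ∃ w ∈ W, ∀ u ∈ U, L w u ≤ b) :
    minMax L W U ≤ (b : EReal) := by
  obtain ⟨w, hw, h⟩ := h
  exact (iInf₂_le w hw).trans (innerMax_le_coe_iff.2 h)

/-- Weak duality, which needs no convexity and hence applies to the auxiliary loss. -/
lemma le_minMax_of_exists {b : ℝ} (h : ∃ u ∈ U, ∀ w ∈ W, b ≤ L w u) :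
    (b : EReal) ≤ minMax L W U := by
  obtain ⟨u, hu, h⟩ := h
  refine le_iInf₂ fun w hw => (EReal.coe_le_coe_iff.2 (h w hw)).trans ?_
  exact le_iSup₂ (f := fun u _ => (L w u : EReal)) u hu

variable {f : (Fin p → ℝ) → (Fin n → ℝ) → ℝ}

/-- Minimax theorem for the primary loss. -/
lemma exists_forall_lt_primaryLoss (hW : IsCompact W) (hW' : Convex ℝ W) (hU : IsCompact U)
    (hU' : Convex ℝ U) (hf : ContinuousOn (Function.uncurry f) (W ×ˢ U))
    (hf_convex : ∀ u ∈ U, ConvexOn ℝ W (fun w => f w u))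
    (hf_concave : ∀ w ∈ W, ConcaveOn ℝ U (fun u => f w u))
    (hne : W.Nonempty) (H : Matrix (Fin p) (Fin n) ℝ) {m : ℝ}
    (h : ∀ w ∈ W, ∃ u ∈ U, m < primaryLoss f H w u) :
    ∃ u ∈ U, ∀ w ∈ W, m < primaryLoss f H w u := by
  have hneU : U.Nonempty := by
    obtain ⟨w, hw⟩ := hne
    obtain ⟨u, hu, -⟩ := h w hw
    exact ⟨u, hu⟩
  -- The Gaussian term is bilinear, so the convexity and concavity of `f` carry over to the primary
  -- loss.
  obtain ⟨w₀, hw₀, u₀, hu₀, hs⟩ := Sion.exists_isSaddlePointOn (f := primaryLoss f H)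
    hne hW' hW
    (fun u hu => by
      have h1 : ContinuousOn (fun w => f w u) W :=
        hf.comp (f := fun w => (w, u)) (by fun_prop) fun w hw => ⟨hw, hu⟩
      have h2 : ContinuousOn (fun w => primaryLoss f H w u) W :=
        (Continuous.continuousOn (by fun_prop)).add h1
      exact h2.lowerSemicontinuousOn)
    (fun u hu => by
      have h1 : ConvexOn ℝ W (fun w => w ⬝ᵥ (H *ᵥ u)) :=
        ⟨hW', fun x _ y _ a b _ _ _ => by simp [add_dotProduct, smul_dotProduct]⟩
      exact (h1.add (hf_convex u hu)).quasiconvexOn)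
    hU' hneU hU
    (fun w hw => by
      have h1 : ContinuousOn (fun u => f w u) U :=
        hf.comp (f := fun u => (w, u)) (by fun_prop) fun u hu => ⟨hw, hu⟩
      have h2 : ContinuousOn (fun u => primaryLoss f H w u) U :=
        (Continuous.continuousOn (by fun_prop)).add h1
      exact h2.upperSemicontinuousOn)
    (fun w hw => by
      have h1 : ConcaveOn ℝ U (fun u => w ⬝ᵥ (H *ᵥ u)) :=
        ⟨hU', fun x _ y _ a b _ _ _ => by
          simp [mulVec_add, mulVec_smul, dotProduct_add, dotProduct_smul]⟩
      exact (h1.add (hf_concave w hw)).quasiconcaveOn)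
  obtain ⟨u, hu, hm⟩ := h w₀ hw₀
  exact ⟨u₀, hu₀, fun w hw => hm.trans_le (hs w hw u hu)⟩

end MinMax

/-- If the auxiliary optimal values over `W` and `W ∩ K` are separated, then a minimizer of the
primary problem lies outside `K`, up to the probability of a deviation of the auxiliary values. -/
theorem measure_minimizer_mem_le {Ω : Type*} [MeasurableSpace Ω] {P : Measure Ω}
    [IsProbabilityMeasure P] {p n M : ℕ}
    {H : Ω → Matrix (Fin p) (Fin n) ℝ} {C : Fin M → Matrix (Fin p) (Fin p) ℝ}
    {D : Fin M → Matrix (Fin n) (Fin n) ℝ} {h : Ω → Fin M → Fin n → ℝ}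
    {g : Ω → Fin M → Fin p → ℝ}
    (hH : IsLowRankGaussian P H C D) (hhg : AreIndepStdGaussian P h g)
    {f : (Fin p → ℝ) → (Fin n → ℝ) → ℝ} {W K : Set (Fin p → ℝ)} {U : Set (Fin n → ℝ)}
    (hW : IsCompact W) (hW' : Convex ℝ W) (hU : IsCompact U) (hU' : Convex ℝ U)
    (hf : ContinuousOn (Function.uncurry f) (W ×ˢ U))
    (hf_convex : ∀ u ∈ U, ConvexOn ℝ W (fun w => f w u))
    (hf_concave : ∀ w ∈ W, ConcaveOn ℝ U (fun u => f w u))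
    (hK : IsCompact K) (hKW : K ⊆ W) {b b' : ℝ} (hbb' : b < b') {what : Ω → Fin p → ℝ}
    (hwhat : ∀ᵐ ω ∂P, IsMinimizer (primaryLoss f (H ω)) W U (what ω)) :
    P {ω | what ω ∈ K} * gaussianReal 0 1 (Set.Iic 0) ^ M
      ≤ P {ω | (b : EReal) ≤ minMax (auxLoss f C D (h ω) (g ω)) W U}
        + P {ω | minMax (auxLoss f C D (h ω) (g ω)) K U ≤ (b' : EReal)} := by
  -- Both comparisons need a strict gap, and a further one separates the thresholds of `E₁` and
  -- `E₂`: `b < m < m' < b'`.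
  obtain ⟨m, hbm, hmb'⟩ := exists_between hbb'
  obtain ⟨m', hmm', hm'b'⟩ := exists_between hmb'
  have h1 := primary_maxmin_gt_le hH hhg hW hU hf hbm
  have h2 := primary_minmax_lt_le hH hhg hK hU (hf.mono (Set.prod_mono hKW subset_rfl)) hm'b'
  set E₁ := {ω | ∃ u ∈ U, ∀ w ∈ W, m < primaryLoss f (H ω) w u}
  set E₂ := {ω | ∃ w ∈ K, ∀ u ∈ U, primaryLoss f (H ω) w u < m'}
  have hsub : P {ω | what ω ∈ K} ≤ P E₁ + P E₂ := by
    refine le_trans (measure_mono_ae ?_) (measure_union_le E₁ E₂)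
    filter_upwards [hwhat] with ω hω hK
    -- The primary optimal value is attained at `what ω ∈ K`. If it is at most `m`, `what ω`
    -- witnesses `E₂`; otherwise every `w` has inner maximum above `m`, and the minimax theorem
    -- gives `E₁`.
    by_cases hle : innerMax (primaryLoss f (H ω)) U (what ω) ≤ (m : EReal)
    · exact Or.inr ⟨what ω, hK, fun u hu => (innerMax_le_coe_iff.1 hle u hu).trans_lt hmm'⟩
    · refine Or.inl (exists_forall_lt_primaryLoss hW hW' hU hU' hf hf_convex hf_concave
        ⟨_, hω.1⟩ (H ω) fun w hw => ?_)
      by_contra! hcon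
      exact hle ((hω.2 w hw).trans (innerMax_le_coe_iff.2 hcon))
  calc P {ω | what ω ∈ K} * gaussianReal 0 1 (Set.Iic 0) ^ M
      ≤ (P E₁ + P E₂) * gaussianReal 0 1 (Set.Iic 0) ^ M := mul_le_mul_left hsub _
    _ = P E₁ * gaussianReal 0 1 (Set.Iic 0) ^ M + P E₂ * gaussianReal 0 1 (Set.Iic 0) ^ M :=
        add_mul _ _ _
    _ ≤ _ := add_le_add
        (h1.trans (measure_mono fun ω hω => le_minMax_of_exists hω))
        (h2.trans (measure_mono fun ω hω => minMax_le_of_exists hω))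

end CGMT

theorem mainTheorem4
    -- a sequence of problems, indexed by `t`, with a fixed number `M` of covariance terms
    (M : ℕ) (p n : ℕ → ℕ)
    {Ω : ℕ → Type*} [∀ t, MeasurableSpace (Ω t)]
    (P : ∀ t, Measure (Ω t)) [∀ t, IsProbabilityMeasure (P t)]
    -- domains and convex-concave function
    (Sw : ∀ t, Set (Fin (p t) → ℝ)) (Su : ∀ t, Set (Fin (n t) → ℝ))
    (hSw : ∀ t, IsCompact (Sw t)) (hSw' : ∀ t, Convex ℝ (Sw t))
    (hSu : ∀ t, IsCompact (Su t)) (hSu' : ∀ t, Convex ℝ (Su t))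
    (f : ∀ t, (Fin (p t) → ℝ) → (Fin (n t) → ℝ) → ℝ)
    (hf : ∀ t, ContinuousOn (Function.uncurry (f t)) (Sw t ×ˢ Su t))
    (hf_convex : ∀ t, ∀ u ∈ Su t, ConvexOn ℝ (Sw t) (fun w => f t w u))
    (hf_concave : ∀ t, ∀ w ∈ Sw t, ConcaveOn ℝ (Su t) (fun u => f t w u))
    -- Gaussian matrix and auxiliary Gaussian vectors
    (C : ∀ t, Fin M → Matrix (Fin (p t)) (Fin (p t)) ℝ)
    (D : ∀ t, Fin M → Matrix (Fin (n t)) (Fin (n t)) ℝ)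
    (H : ∀ t, Ω t → Matrix (Fin (p t)) (Fin (n t)) ℝ)
    (hH : ∀ t, CGMT.IsLowRankGaussian (P t) (H t) (C t) (D t))
    (h : ∀ t, Ω t → Fin M → Fin (n t) → ℝ) (g : ∀ t, Ω t → Fin M → Fin (p t) → ℝ)
    (hhg : ∀ t, CGMT.AreIndepStdGaussian (P t) (h t) (g t))
    -- relatively open subsets of the domains
    (A : ∀ t, Set (Fin (p t) → ℝ)) (hA : ∀ t, ∃ V, IsOpen V ∧ A t = Sw t ∩ V)
    -- convergence of the auxiliary optimal values
    (c c' : ℝ) (hcc' : c < c')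
    (hψ : CGMT.TendstoInProb P
      (fun t ω => CGMT.minMax (CGMT.auxLoss (f t) (C t) (D t) (h t ω) (g t ω)) (Sw t) (Su t)) c)
    (hψ' : CGMT.TendstoInProb P
      (fun t ω => CGMT.minMax (CGMT.auxLoss (f t) (C t) (D t) (h t ω) (g t ω))
        (Sw t \ A t) (Su t)) c')
    -- any (selection of a) minimizer of the primary problem
    (what : ∀ t, Ω t → Fin (p t) → ℝ)
    (hwhat : ∀ t, ∀ᵐ ω ∂(P t),
      CGMT.IsMinimizer (CGMT.primaryLoss (f t) (H t ω)) (Sw t) (Su t) (what t ω)) :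
    Tendsto (fun t => P t {ω | what t ω ∈ A t}) atTop (𝓝 1) := by
  set γ := gaussianReal 0 1 (Set.Iic 0) ^ M with hγ
  have hγ0 : γ ≠ 0 := pow_ne_zero _ CGMT.gaussianReal_Iic_ne_zero
  have hγtop : γ ≠ ⊤ := ENNReal.pow_ne_top (measure_ne_top _ _)
  -- A third of the gap ensures `c + ε < c' - ε`.
  set ε := (c' - c) / 3 with hε
  have hε0 : 0 < ε := by linarith
  set q : ℕ → ENNReal := fun t =>
    (P t {ω | CGMT.minMax (CGMT.auxLoss (f t) (C t) (D t) (h t ω) (g t ω)) (Sw t) (Su t)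
        ≤ ((c - ε : ℝ) : EReal) ∨ ((c + ε : ℝ) : EReal)
        ≤ CGMT.minMax (CGMT.auxLoss (f t) (C t) (D t) (h t ω) (g t ω)) (Sw t) (Su t)}
      + P t {ω | CGMT.minMax (CGMT.auxLoss (f t) (C t) (D t) (h t ω) (g t ω)) (Sw t \ A t) (Su t)
        ≤ ((c' - ε : ℝ) : EReal) ∨ ((c' + ε : ℝ) : EReal)
        ≤ CGMT.minMax (CGMT.auxLoss (f t) (C t) (D t) (h t ω) (g t ω)) (Sw t \ A t) (Su t)}) / γ
    with hq
  have hq0 : Tendsto q atTop (𝓝 0) := by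
    have := ENNReal.Tendsto.div_const ((hψ ε hε0).add (hψ' ε hε0)) (b := γ) (Or.inr hγ0)
    rw [add_zero, ENNReal.zero_div] at this
    exact this
  have hbad : ∀ t, P t {ω | what t ω ∈ Sw t \ A t} ≤ q t := by
    intro t
    have hK : IsCompact (Sw t \ A t) := by
      obtain ⟨V, hV, hAV⟩ := hA t
      rw [hAV, Set.sdiff_self_inter]
      exact (hSw t).diff hV
    rw [hq, ENNReal.le_div_iff_mul_le (Or.inl hγ0) (Or.inl hγtop)]
    refine (CGMT.measure_minimizer_mem_le (hH t) (hhg t) (hSw t) (hSw' t) (hSu t) (hSu' t) (hf t)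
      (hf_convex t) (hf_concave t) hK Set.sdiff_subset (b := c + ε) (b' := c' - ε)
      (by linarith) (hwhat t)).trans ?_
    exact add_le_add (measure_mono fun ω hω => Or.inr hω) (measure_mono fun ω hω => Or.inl hω)
  have hgood : ∀ t, 1 - q t ≤ P t {ω | what t ω ∈ A t} := by
    intro t
    rw [tsub_le_iff_right]
    -- The selection `what` need not be measurable, so subadditivity replaces passing to the
    -- complement.
    have hcover : (1 : ENNReal) ≤ P t ({ω | what t ω ∈ A t} ∪ {ω | what t ω ∈ Sw t \ A t}) := by
      rw [← measure_univ (μ := P t)]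
      refine measure_mono_ae ?_
      filter_upwards [hwhat t] with ω hω _
      by_cases hmem : what t ω ∈ A t
      · exact Or.inl hmem
      · exact Or.inr ⟨hω.1, hmem⟩
    exact hcover.trans ((measure_union_le _ _).trans (add_le_add le_rfl (hbad t)))
  have hlim : Tendsto (fun t => 1 - q t) atTop (𝓝 1) := by
    have := ENNReal.Tendsto.sub (tendsto_const_nhds (x := (1 : ENNReal))) hq0
      (Or.inl ENNReal.one_ne_top)
    simpa using this
  exact tendsto_of_tendsto_of_tendsto_of_le_of_le hlim tendsto_const_nhds hgood
    fun t => prob_le_one
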